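/- **Conventions.** An *operator space* is a complex vector space $X$ with norms on all matrix spaces $M_{m,n}(X)$ such that $\|x\oplus y\|=\max\{\|x\|,\|y\|\}$ and $\|\alpha x\beta\|\le\|\alpha\|\,\|x\|\,\|\beta\|$ for scalar matrices $\alpha,\beta$ of suitable sizes (carrying the operator norm). Let $C_2(X)=M_{2,1}(X)$ and $R_2(X)=M_{1,2}(X)$ with the operator space structures $M_n(C_2(X))=M_{2n,n}(X)$ and $M_n(R_2(X))=M_{n,2n}(X)$, and let $C_2[X]=C_2(\mathbb C)\,\hat\otimes\,X$ and $R_2[X]=R_2(\mathbb C)\,\hat\otimes\,X$ be the projective operator space tensor products, where $\|u\|=\inf\{\|\alpha\|\|x\|\|y\|\|\beta\| : u=\alpha(x\otimes y)\beta\}$ for a matrix $u$ over $X\otimes Y$, with $x$ and $y$ matrices over $X$ and $Y$ and $\alpha,\beta$ scalar matrices. For a linear map $P:X\to X$ with $P^2=P$ let $\nu_P(x)=(Px,\,x-Px)$. Then $P$ is a *left $M$-*, *right $M$-*, *left $L$-* or *right $L$-projection* if $\nu_P$ is an isometry of $X$ into $C_2(X)$, $R_2(X)$, $C_2[X]$ or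 $R_2[X]$, respectively. $P$ is a *complete* left (right) $M$-projection if for every $n$ its entrywise amplification $P_n:M_n(X)\to M_n(X)$ is a left (right) $M$-projection, and a *complete* left (right) $L$-projection if $\nu_P:X\to C_2[X]$ (respectively $\nu_P:X\to R_2[X]$) is a complete isometry. Let $H$ be a complex Hilbert space, with the following operator space structures: $H_c=B(\mathbb C,H)$ (column); $H_r=B(H^*,\mathbb C)$ (row); Pisier's self-dual $H_o$, where $\|[x_{ij}]\|=\big\|[\langle x_{ij},x_{kl}\rangle]_{(i,k),(j,l)}\big\|^{1/2}$; $MIN(H)$, where $\|[x_{ij}]\|=\sup\{\|[f(x_{ij})]\| : f\in H^*,\ \|f\|\le 1\}$; and $MAX(H)$, whose matrix norms are the suprema of the matrix norms over all operator space structures on $H$ with the given norm on $H=M_1(H)$. Let $I$ be the identity on $H$ and let $\mathrm{Proj}(B(H))$ be the set of orthogonal projections on $H$. **Proposition.** The sets of all one-sided $M$- and $L$-projections of these operator spaces are $$\begin{array}{l|c|c|c|c} & \text{left } M & \text{right } L & \text{right } M & \text{left } L\\ \hline H_c & \mathrm{Proj}(B(H)) & \{0,I\} & \{0,I\} & \mathrm{Proj}(B(H))\\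 H_r & \{0,I\} & \mathrm{Proj}(B(H)) & \mathrm{Proj}(B(H)) & \{0,I\}\\ H_o & \{0,I\} & \{0,I\} & \{0,I\} & \{0,I\}\\ MIN(H) & \{0,I\} & \mathrm{Proj}(B(H)) & \{0,I\} & \mathrm{Proj}(B(H))\\ MAX(H) & \mathrm{Proj}(B(H)) & \{0,I\} & \mathrm{Proj}(B(H)) & \{0,I\} \end{array}$$ The rows of $H_c$, $H_r$ and $H_o$ are also valid for the complete one-sided $M$- and $L$-projections. However, the complete left $M$-projections of $MAX(H)$ are only $0$ and $I$, and so are its complete right $M$-projections; the complete left $L$-projections of $MIN(H)$ are only $0$ and $I$, and so are its complete right $L$-projections. -/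

import Mathlib

open scoped TensorProduct

noncomputable section

/-! ### Matrix norms and operator spaces -/

/-- The norm of a rectangular scalar matrix, as an operator between Euclidean spaces. -/
def scalarOpNorm {m n : Type} [Fintype m] [Fintype n] (A : Matrix m n ℂ) : ℝ :=
  letI : DecidableEq n := Classical.decEq n
  ‖Matrix.toEuclideanLin.trans LinearMap.toContinuousLinearMap A‖

/-- A system of real-valued functions on all the rectangular matrix spaces `M_{m,n}(X)`
(with arbitrary finite index sets). -/
structure MatrixNorms (X : Type*) where
  nrm : ∀ {m n : Type} [Fintype m] [Fintype n], Matrix m n X → ℝ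

/-- The two-sided action `α x β` of scalar matrices on a matrix over a vector space. -/
def Matrix.bimul {X : Type*} [AddCommGroup X] [Module ℂ X] {p m n q : Type}
    [Fintype m] [Fintype n] (α : Matrix p m ℂ) (x : Matrix m n X) (β : Matrix n q ℂ) :
    Matrix p q X :=
  Matrix.of fun i j => ∑ k, ∑ l, (α i k * β l j) • x k l

/-- The matrix of elementary tensors `x ⊗ y`, with rows and columns indexed by pairs. -/
def Matrix.tensorMat {X Y : Type*} [AddCommGroup X] [Module ℂ X] [AddCommGroup Y] [Module ℂ Y]
    {p q r s : Type} (x : Matrix p q X) (y : Matrix r s Y) :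
    Matrix (p × r) (q × s) (X ⊗[ℂ] Y) :=
  Matrix.of fun i j => x i.1 j.1 ⊗ₜ[ℂ] y i.2 j.2

/-- The operator `[T i j] : K^n → L^m` defined by a matrix of operators, where `K^n` and `L^m`
are the `ℓ²`-direct sums. -/
def operatorMatrix {K L : Type*} [NormedAddCommGroup K] [NormedSpace ℂ K]
    [NormedAddCommGroup L] [NormedSpace ℂ L] {m n : Type} [Fintype m] [Fintype n]
    (T : Matrix m n (K →L[ℂ] L)) :
    PiLp 2 (fun _ : n => K) →L[ℂ] PiLp 2 (fun _ : m => L) :=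
  (PiLp.continuousLinearEquiv 2 ℂ (fun _ : m => L)).symm.toContinuousLinearMap ∘L
    ContinuousLinearMap.pi fun i => ∑ j, T i j ∘L PiLp.proj 2 (fun _ : n => K) j

namespace MatrixNorms

/-- The norm of an element of `X`, regarded as a `1 × 1` matrix. -/
def one {X : Type*} (o : MatrixNorms X) (x : X) : ℝ :=
  o.nrm (Matrix.of fun (_ _ : Unit) => x)

/-- The axioms of an operator space: every `M_{m,n}(X)` is normed, the norm of a diagonal direct
sum is the maximum of the norms, and the scalar matrices act contractively. (As `α` and `β` may be
rectangular, the square matrix norms determine all the others, and conversely a system of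
square matrix norms with these properties extends to the rectangular matrices.) -/
structure IsOperatorSpace {X : Type*} [AddCommGroup X] [Module ℂ X] (o : MatrixNorms X) :
    Prop where
  add_le : ∀ {m n : Type} [Fintype m] [Fintype n] (x y : Matrix m n X),
    o.nrm (x + y) ≤ o.nrm x + o.nrm y
  smul_eq : ∀ {m n : Type} [Fintype m] [Fintype n] (c : ℂ) (x : Matrix m n X),
    o.nrm (c • x) = ‖c‖ * o.nrm x
  eq_zero : ∀ {m n : Type} [Fintype m] [Fintype n] (x : Matrix m n X),
    o.nrm x = 0 → x = 0
  directSum : ∀ {m n p q : Type} [Fintype m] [Fintype n] [Fintype p] [Fintype q]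
    (x : Matrix m n X) (y : Matrix p q X),
    o.nrm (Matrix.fromBlocks x 0 0 y) = max (o.nrm x) (o.nrm y)
  bimul_le : ∀ {p m n q : Type} [Fintype p] [Fintype m] [Fintype n] [Fintype q]
    (α : Matrix p m ℂ) (x : Matrix m n X) (β : Matrix n q ℂ),
    o.nrm (Matrix.bimul α x β) ≤ scalarOpNorm α * o.nrm x * scalarOpNorm β

/-- The matrix norms on `X` coming from a map of `X` into the bounded operators `K → L`. -/
def concrete {X K L : Type*} [NormedAddCommGroup K] [NormedSpace ℂ K]
    [NormedAddCommGroup L] [NormedSpace ℂ L] (σ : X → (K →L[ℂ] L)) : MatrixNorms X where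
  nrm x := ‖operatorMatrix (x.map σ)‖

/-- The scalars `ℂ` with their standard matrix norms. -/
def scalars : MatrixNorms ℂ where
  nrm x := scalarOpNorm x

/-! ### Constructions: `M_n(X)`, `C₂(X)`, `R₂(X)`, projective tensor products, `C₂[X]`, `R₂[X]` -/

/-- The operator space `M_n(X)`: a matrix of matrices is regarded as one large matrix. -/
def amplify {X : Type*} (o : MatrixNorms X) (n : ℕ) : MatrixNorms (Matrix (Fin n) (Fin n) X) where
  nrm {m k} _ _ x := o.nrm (Matrix.comp m k (Fin n) (Fin n) X x)

/-- The operator space `C₂(X)` of columns of length two: a matrix of columns is regarded as a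
matrix over `X` with twice as many rows. -/
def col {X : Type*} (o : MatrixNorms X) : MatrixNorms (Fin 2 → X) where
  nrm {m n} _ _ x := o.nrm (Matrix.of fun (i : m × Fin 2) (j : n) => x i.1 j i.2)

/-- The operator space `R₂(X)` of rows of length two: a matrix of rows is regarded as a
matrix over `X` with twice as many columns. -/
def row {X : Type*} (o : MatrixNorms X) : MatrixNorms (Fin 2 → X) where
  nrm {m n} _ _ x := o.nrm (Matrix.of fun (i : m) (j : n × Fin 2) => x i j.1 j.2)

/-- The projective operator space tensor norms on `X ⊗ Y`: the infimum of
`‖α‖ ‖x‖ ‖y‖ ‖β‖` over all the factorizations `u = α (x ⊗ y) β`. -/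
def proj {X Y : Type*} [AddCommGroup X] [Module ℂ X] [AddCommGroup Y] [Module ℂ Y]
    (oX : MatrixNorms X) (oY : MatrixNorms Y) : MatrixNorms (X ⊗[ℂ] Y) where
  nrm {m n} _ _ u := sInf {t : ℝ | ∃ (p q r s : ℕ) (α : Matrix m (Fin p × Fin r) ℂ)
    (x : Matrix (Fin p) (Fin q) X) (y : Matrix (Fin r) (Fin s) Y)
    (β : Matrix (Fin q × Fin s) n ℂ),
    u = Matrix.bimul α (Matrix.tensorMat x y) β ∧
      t = scalarOpNorm α * oX.nrm x * oY.nrm y * scalarOpNorm β}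

/-- The identification of `X ⊕ X` with `ℂ² ⊗ X`. -/
def toTensor {X : Type*} [AddCommGroup X] [Module ℂ X] (v : Fin 2 → X) : (Fin 2 → ℂ) ⊗[ℂ] X :=
  ∑ k, (Pi.single k 1 : Fin 2 → ℂ) ⊗ₜ[ℂ] v k

/-- The operator space `C₂[X]`, the projective tensor product of `C₂ = C₂(ℂ)` and `X`. -/
def colProj {X : Type*} [AddCommGroup X] [Module ℂ X] (o : MatrixNorms X) :
    MatrixNorms (Fin 2 → X) where
  nrm x := (proj (col scalars) o).nrm (x.map toTensor)

/-- The operator space `R₂[X]`, the projective tensor product of `R₂ = R₂(ℂ)` and `X`. -/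
def rowProj {X : Type*} [AddCommGroup X] [Module ℂ X] (o : MatrixNorms X) :
    MatrixNorms (Fin 2 → X) where
  nrm x := (proj (row scalars) o).nrm (x.map toTensor)

/-- A map is a complete isometry if all its entrywise amplifications preserve the norm. -/
def IsCompleteIsometry {X Y : Type*} (oX : MatrixNorms X) (oY : MatrixNorms Y) (φ : X → Y) :
    Prop :=
  ∀ (n : ℕ) (x : Matrix (Fin n) (Fin n) X), oY.nrm (x.map φ) = oX.nrm x

/-! ### One-sided `M`- and `L`-projections -/

/-- The map `x ↦ (P x, x - P x)`. -/
def splitMap {X : Type*} [AddCommGroup X] [Module ℂ X] (P : X →ₗ[ℂ] X) (x : X) : Fin 2 → X :=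
  ![P x, x - P x]

section Projections

variable {X : Type*} [AddCommGroup X] [Module ℂ X] (o : MatrixNorms X)

/-- The left `M`-projections. -/
def leftM : Set (X →ₗ[ℂ] X) :=
  {P | P ∘ₗ P = P ∧ ∀ x, o.one x = o.col.one (splitMap P x)}

/-- The right `M`-projections. -/
def rightM : Set (X →ₗ[ℂ] X) :=
  {P | P ∘ₗ P = P ∧ ∀ x, o.one x = o.row.one (splitMap P x)}

/-- The left `L`-projections. -/
def leftL : Set (X →ₗ[ℂ] X) :=
  {P | P ∘ₗ P = P ∧ ∀ x, o.one x = o.colProj.one (splitMap P x)}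

/-- The right `L`-projections. -/
def rightL : Set (X →ₗ[ℂ] X) :=
  {P | P ∘ₗ P = P ∧ ∀ x, o.one x = o.rowProj.one (splitMap P x)}

/-- The complete left `M`-projections: every entrywise amplification `P_n` is a left
`M`-projection of `M_n(X)`. -/
def completeLeftM : Set (X →ₗ[ℂ] X) :=
  {P | ∀ n : ℕ, P.mapMatrix ∈ (o.amplify n).leftM}

/-- The complete right `M`-projections: every entrywise amplification `P_n` is a right
`M`-projection of `M_n(X)`. -/
def completeRightM : Set (X →ₗ[ℂ] X) :=
  {P | ∀ n : ℕ, P.mapMatrix ∈ (o.amplify n).rightM}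

/-- The complete left `L`-projections. -/
def completeLeftL : Set (X →ₗ[ℂ] X) :=
  {P | P ∘ₗ P = P ∧ IsCompleteIsometry o o.colProj (splitMap P)}

/-- The complete right `L`-projections. -/
def completeRightL : Set (X →ₗ[ℂ] X) :=
  {P | P ∘ₗ P = P ∧ IsCompleteIsometry o o.rowProj (splitMap P)}

end Projections

/-! ### The quantizations of a Hilbert space -/

section Hilbert

variable (H : Type*) [NormedAddCommGroup H] [InnerProductSpace ℂ H]

/-- The column Hilbert space `H_c = B(ℂ, H)`. -/
def columnHilbert : MatrixNorms H :=
  concrete fun ξ : H => ContinuousLinearMap.toSpanSingleton ℂ ξ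

/-- The row Hilbert space `H_r = B(H*, ℂ)`. -/
def rowHilbert : MatrixNorms H :=
  concrete fun ξ : H => NormedSpace.inclusionInDoubleDual ℂ H ξ

/-- Pisier's self-dual operator Hilbert space `H_o`, with
`‖[x i j]‖ = ‖[⟪x i j, x k l⟫]‖ ^ (1/2)`, rows indexed by `(i, k)` and columns by `(j, l)`. -/
def operatorHilbert : MatrixNorms H where
  nrm {m n} _ _ x := Real.sqrt (scalarOpNorm
    (Matrix.of fun (i : m × m) (j : n × n) => inner ℂ (x i.1 j.1) (x i.2 j.2)))

/-- `MIN(H)`: the matrix norms given by the contractive functionals. -/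
def minHilbert : MatrixNorms H where
  nrm x := sSup {t : ℝ | ∃ f : StrongDual ℂ H, ‖f‖ ≤ 1 ∧ t = scalarOpNorm (x.map f)}

/-- `MAX(H)`: the largest operator space structure whose norm on `H` is the given one. -/
def maxHilbert : MatrixNorms H where
  nrm x := sSup {t : ℝ | ∃ o : MatrixNorms H,
    o.IsOperatorSpace ∧ (∀ ξ, o.one ξ = ‖ξ‖) ∧ t = o.nrm x}

/-- `Proj(B(H))`, the orthogonal projections on `H`. -/
def orthProj [CompleteSpace H] : Set (H →ₗ[ℂ] H) :=
  {P | ∃ p : H →L[ℂ] H, IsStarProjection p ∧ (p : H →ₗ[ℂ] H) = P}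

/-- The set `{0, I}`. -/
def trivialProj : Set (H →ₗ[ℂ] H) := {0, LinearMap.id}

end Hilbert

end MatrixNorms

end

/-!
Contractive idempotents on a Hilbert space are orthogonal projections, which bounds every entry of
the table above by `Proj(B(H))`. If such a `P` is not `0` or `I`, pick unit vectors `u` in its range
and `v` in its kernel; then `‖u + v‖ = √2`, and an entry collapses to `{0, I}` as soon as the norm
of `(u, v)` in `C₂(X)` or `C₂[X]` is different from `√2`. A column of `M_{2,1}(X)` is read off
directly, while the norm of `C₂[X]` is the infimum of `‖y‖‖β‖` over the factorizations
`(e ⊗ y)β`. For `MIN(H)` and `MAX(H)` the complete versions fail already on `2 × 2` matrices built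
from `u` and `v`.

Transposing all matrices exchanges left and right, `H_c` and `H_r`, and fixes `H_o`, `MIN(H)` and
`MAX(H)`, so only the left projections have to be determined.
-/

noncomputable section

namespace MatrixNorms

/-! ### Scalar matrices -/

section Scalar

variable {m n p : Type} [Fintype m] [Fintype n] [Fintype p]

open scoped Matrix.Norms.L2Operator in
theorem scalarOpNorm_eq_l2_opNorm [DecidableEq n] (A : Matrix m n ℂ) : scalarOpNorm A = ‖A‖ := by
  rw [Matrix.l2_opNorm_def, scalarOpNorm, Subsingleton.elim (Classical.decEq n)]

theorem scalarOpNorm_nonneg (A : Matrix m n ℂ) : 0 ≤ scalarOpNorm A := norm_nonneg _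

theorem sum_norm_sq_mul_le (A : Matrix m n ℂ) (v : n → ℂ) :
    ∑ i, ‖∑ j, A i j * v j‖ ^ 2 ≤ scalarOpNorm A ^ 2 * ∑ j, ‖v j‖ ^ 2 := by
  classical
  have h := pow_le_pow_left₀ (norm_nonneg _) (Matrix.l2_opNorm_mulVec A (WithLp.toLp 2 v)) 2
  rw [mul_pow, PiLp.norm_sq_eq_of_L2, PiLp.norm_sq_eq_of_L2, ← scalarOpNorm_eq_l2_opNorm] at h
  exact h

theorem scalarOpNorm_le {A : Matrix m n ℂ} {C : ℝ} (hC : 0 ≤ C)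
    (h : ∀ v : n → ℂ, ∑ i, ‖∑ j, A i j * v j‖ ^ 2 ≤ C ^ 2 * ∑ j, ‖v j‖ ^ 2) :
    scalarOpNorm A ≤ C := by
  refine ContinuousLinearMap.opNorm_le_bound _ hC fun v => le_of_sq_le_sq ?_ (by positivity)
  rw [mul_pow, PiLp.norm_sq_eq_of_L2, PiLp.norm_sq_eq_of_L2]
  exact h v

theorem scalarOpNorm_map_conj (A : Matrix m n ℂ) :
    scalarOpNorm (A.map (starRingEnd ℂ)) = scalarOpNorm A := by
  have map_conj_le (B : Matrix m n ℂ) :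
      scalarOpNorm (B.map (starRingEnd ℂ)) ≤ scalarOpNorm B := by
    refine scalarOpNorm_le (scalarOpNorm_nonneg B) fun v => ?_
    have h := sum_norm_sq_mul_le B fun j => starRingEnd ℂ (v j)
    simp only [RCLike.norm_conj] at h
    refine le_of_eq_of_le (Finset.sum_congr rfl fun i _ => ?_) h
    rw [← RCLike.norm_conj]
    simp
  refine (map_conj_le A).antisymm (le_of_eq_of_le (congrArg scalarOpNorm ?_) (map_conj_le _))
  ext i j
  simp

theorem scalarOpNorm_transpose (A : Matrix m n ℂ) : scalarOpNorm A.transpose = scalarOpNorm A := by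
  classical
  rw [← scalarOpNorm_map_conj A.transpose, scalarOpNorm_eq_l2_opNorm, scalarOpNorm_eq_l2_opNorm]
  exact Matrix.l2_opNorm_conjTranspose A

theorem scalarOpNorm_of_const [Unique m] [Unique n] (c : ℂ) :
    scalarOpNorm (Matrix.of fun (_ : m) (_ : n) => c) = ‖c‖ := by
  refine le_antisymm (scalarOpNorm_le (norm_nonneg _) fun v => ?_) ?_
  · simp [mul_pow]
  · have h := sum_norm_sq_mul_le (Matrix.of fun (_ : m) (_ : n) => c) fun _ => 1
    simp only [Finset.univ_unique, Matrix.of_apply, mul_one, Finset.sum_singleton, norm_one,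
      one_pow] at h
    exact le_of_sq_le_sq h (scalarOpNorm_nonneg _)

theorem scalarOpNorm_one_submatrix_left_le [DecidableEq m] {f : p → m}
    (hf : Function.Injective f) : scalarOpNorm ((1 : Matrix m m ℂ).submatrix f id) ≤ 1 := by
  refine scalarOpNorm_le zero_le_one fun v => ?_
  simp only [Matrix.submatrix_apply, id, Matrix.one_apply, ite_mul, one_mul, zero_mul,
    Finset.sum_ite_eq, Finset.mem_univ, if_true, one_pow]
  calc ∑ i, ‖v (f i)‖ ^ 2 = ∑ k ∈ Finset.univ.map ⟨f, hf⟩, ‖v k‖ ^ 2 := by simp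
    _ ≤ ∑ k, ‖v k‖ ^ 2 := Finset.sum_le_sum_of_subset_of_nonneg (Finset.subset_univ _)
      fun _ _ _ => by positivity

theorem scalarOpNorm_one_submatrix_right_le [DecidableEq m] {f : p → m}
    (hf : Function.Injective f) : scalarOpNorm ((1 : Matrix m m ℂ).submatrix id f) ≤ 1 := by
  rw [← scalarOpNorm_transpose, Matrix.transpose_submatrix, Matrix.transpose_one]
  exact scalarOpNorm_one_submatrix_left_le hf

end Scalar

/-! ### The column Hilbert space -/

section Orthonormal

variable {K : Type*} [NormedAddCommGroup K] [InnerProductSpace ℂ K]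

theorem exists_orthonormal_span {ι : Type*} [Finite ι] (y : ι → K) :
    ∃ (d : ℕ) (b : Fin d → K), Orthonormal ℂ b ∧ ∀ i, y i = ∑ k, inner ℂ (b k) (y i) • b k := by
  have : FiniteDimensional ℂ (Submodule.span ℂ (Set.range y)) :=
    FiniteDimensional.span_of_finite ℂ (Set.finite_range y)
  let b := stdOrthonormalBasis ℂ (Submodule.span ℂ (Set.range y))
  refine ⟨_, fun k => (b k : K), b.orthonormal.comp_linearIsometry (Submodule.subtypeₗᵢ _),
    fun i => ?_⟩
  have h := congrArg Subtype.val (b.sum_repr' ⟨y i, Submodule.subset_span ⟨i, rfl⟩⟩)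
  simpa using h.symm

theorem norm_sq_sum_smul_of_orthonormal {ι : Type*} [Fintype ι] {b : ι → K}
    (hb : Orthonormal ℂ b) (c : ι → ℂ) : ‖∑ k, c k • b k‖ ^ 2 = ∑ k, ‖c k‖ ^ 2 := by
  have h := hb.inner_sum c c Finset.univ
  rw [inner_self_eq_norm_sq_to_K] at h
  simp only [Complex.conj_mul'] at h
  rw [← Complex.ofReal_inj]
  push_cast
  exact h

theorem sum_norm_sq_smul_le {m n : Type} [Fintype m] [Fintype n] (A : Matrix m n ℂ) (y : n → K) :
    ∑ i, ‖∑ j, A i j • y j‖ ^ 2 ≤ scalarOpNorm A ^ 2 * ∑ j, ‖y j‖ ^ 2 := by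
  obtain ⟨d, b, hb, hy⟩ := exists_orthonormal_span y
  have coeff (i) : ‖∑ j, A i j • y j‖ ^ 2 = ∑ k, ‖∑ j, A i j * inner ℂ (b k) (y j)‖ ^ 2 := by
    rw [← norm_sq_sum_smul_of_orthonormal hb]
    simp only [Finset.sum_smul, mul_smul]
    rw [Finset.sum_comm]
    simp only [← Finset.smul_sum, ← hy]
  have parseval (j) : ‖y j‖ ^ 2 = ∑ k, ‖inner ℂ (b k) (y j)‖ ^ 2 := by
    rw [← norm_sq_sum_smul_of_orthonormal hb, ← hy]
  simp only [coeff, parseval]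
  rw [Finset.sum_comm, Finset.sum_comm (s := (Finset.univ : Finset n)), Finset.mul_sum]
  exact Finset.sum_le_sum fun k _ => sum_norm_sq_mul_le A _

end Orthonormal

section Concrete

variable {X K L : Type*} [NormedAddCommGroup K] [NormedSpace ℂ K] [NormedAddCommGroup L]
  [NormedSpace ℂ L] (σ : X → K →L[ℂ] L)
variable {m n : Type} [Fintype m] [Fintype n]

theorem operatorMatrix_apply (T : Matrix m n (K →L[ℂ] L)) (v : PiLp 2 (fun _ : n => K)) (i : m) :
    operatorMatrix T v i = ∑ j, T i j (v j) := by
  simp [operatorMatrix]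

theorem concrete_nonneg (x : Matrix m n X) : 0 ≤ (concrete σ).nrm x :=
  ContinuousLinearMap.opNorm_nonneg _

theorem sum_norm_sq_apply_le_concrete (x : Matrix m n X) (v : n → K) :
    ∑ i, ‖∑ j, σ (x i j) (v j)‖ ^ 2 ≤ (concrete σ).nrm x ^ 2 * ∑ j, ‖v j‖ ^ 2 := by
  have h := pow_le_pow_left₀ (norm_nonneg _) (ContinuousLinearMap.le_opNorm
    (operatorMatrix (x.map σ)) (WithLp.toLp 2 v)) 2
  rw [mul_pow, PiLp.norm_sq_eq_of_L2, PiLp.norm_sq_eq_of_L2] at h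
  simp only [operatorMatrix_apply] at h
  exact h

variable {σ} in
theorem concrete_le {x : Matrix m n X} {C : ℝ} (hC : 0 ≤ C)
    (h : ∀ v : n → K, ∑ i, ‖∑ j, σ (x i j) (v j)‖ ^ 2 ≤ C ^ 2 * ∑ j, ‖v j‖ ^ 2) :
    (concrete σ).nrm x ≤ C := by
  refine ContinuousLinearMap.opNorm_le_bound _ hC fun v => le_of_sq_le_sq ?_ (by positivity)
  rw [mul_pow, PiLp.norm_sq_eq_of_L2, PiLp.norm_sq_eq_of_L2]
  simpa only [operatorMatrix_apply, Matrix.map_apply] using h v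

end Concrete

section ColumnHilbert

variable {K : Type*} [NormedAddCommGroup K] [InnerProductSpace ℂ K]
variable {m n p q : Type} [Fintype m] [Fintype n] [Fintype p] [Fintype q]

theorem columnHilbert_nonneg (x : Matrix m n K) : 0 ≤ (columnHilbert K).nrm x :=
  concrete_nonneg _ x

theorem sum_norm_sq_smul_le_columnHilbert (x : Matrix m n K) (v : n → ℂ) :
    ∑ i, ‖∑ j, v j • x i j‖ ^ 2 ≤ (columnHilbert K).nrm x ^ 2 * ∑ j, ‖v j‖ ^ 2 :=
  sum_norm_sq_apply_le_concrete (fun ξ : K => ContinuousLinearMap.toSpanSingleton ℂ ξ) x v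

theorem columnHilbert_le {x : Matrix m n K} {C : ℝ} (hC : 0 ≤ C)
    (h : ∀ v : n → ℂ, ∑ i, ‖∑ j, v j • x i j‖ ^ 2 ≤ C ^ 2 * ∑ j, ‖v j‖ ^ 2) :
    (columnHilbert K).nrm x ≤ C :=
  concrete_le hC h

theorem columnHilbert_le_of_forall_sum_le {K' : Type*} [NormedAddCommGroup K']
    [InnerProductSpace ℂ K'] {x : Matrix m n K} {y : Matrix p n K'}
    (h : ∀ v : n → ℂ, ∑ i, ‖∑ j, v j • x i j‖ ^ 2 ≤ ∑ i, ‖∑ j, v j • y i j‖ ^ 2) :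
    (columnHilbert K).nrm x ≤ (columnHilbert K').nrm y :=
  columnHilbert_le (columnHilbert_nonneg y) fun v =>
    (h v).trans (sum_norm_sq_smul_le_columnHilbert y v)

theorem columnHilbert_one (ξ : K) : (columnHilbert K).one ξ = ‖ξ‖ := by
  refine le_antisymm (columnHilbert_le (norm_nonneg _) fun v => ?_) ?_
  · simp [norm_smul, mul_pow, mul_comm]
  · have h := sum_norm_sq_smul_le_columnHilbert (Matrix.of fun (_ _ : Unit) => ξ) fun _ => 1
    simp only [Finset.univ_unique, Matrix.of_apply, one_smul, Finset.sum_singleton, norm_one,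
      one_pow, mul_one] at h
    exact le_of_sq_le_sq h (columnHilbert_nonneg _)

theorem columnHilbert_add_le (x y : Matrix m n K) :
    (columnHilbert K).nrm (x + y) ≤ (columnHilbert K).nrm x + (columnHilbert K).nrm y := by
  refine le_of_eq_of_le (congrArg norm ?_) (ContinuousLinearMap.opNorm_add_le
    (operatorMatrix (x.map fun ξ : K => ContinuousLinearMap.toSpanSingleton ℂ ξ))
    (operatorMatrix (y.map fun ξ : K => ContinuousLinearMap.toSpanSingleton ℂ ξ)))
  ext v i
  simp [operatorMatrix, Finset.sum_add_distrib]

theorem columnHilbert_smul (c : ℂ) (x : Matrix m n K) :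
    (columnHilbert K).nrm (c • x) = ‖c‖ * (columnHilbert K).nrm x := by
  have smul_le (c : ℂ) (x : Matrix m n K) :
      (columnHilbert K).nrm (c • x) ≤ ‖c‖ * (columnHilbert K).nrm x := by
    refine columnHilbert_le (mul_nonneg (norm_nonneg c) (columnHilbert_nonneg x)) fun v => ?_
    simp only [Matrix.smul_apply, smul_comm _ c, ← Finset.smul_sum, norm_smul, mul_pow,
      ← Finset.mul_sum, mul_assoc]
    gcongr
    exact sum_norm_sq_smul_le_columnHilbert x v
  rcases eq_or_ne c 0 with rfl | hc
  · exact (smul_le 0 x).antisymm (by simpa using columnHilbert_nonneg _)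
  · refine (smul_le c x).antisymm ?_
    have h := smul_le c⁻¹ (c • x)
    rwa [inv_smul_smul₀ hc, norm_inv, le_inv_mul_iff₀ (norm_pos_iff.2 hc)] at h

theorem eq_zero_of_columnHilbert_eq_zero {x : Matrix m n K} (h : (columnHilbert K).nrm x = 0) :
    x = 0 := by
  classical
  ext i j
  have hj := sum_norm_sq_smul_le_columnHilbert x (Pi.single j 1)
  simp only [h, Pi.single_apply, ite_smul, one_smul, zero_smul, Finset.sum_ite_eq',
    Finset.mem_univ, if_true, ne_eq, OfNat.ofNat_ne_zero, not_false_eq_true, zero_pow,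
    zero_mul] at hj
  simpa using (Finset.sum_eq_zero_iff_of_nonneg fun _ _ => by positivity).1
    (hj.antisymm (by positivity)) i (Finset.mem_univ i)

theorem columnHilbert_fromBlocks (x : Matrix m n K) (y : Matrix p q K) :
    (columnHilbert K).nrm (Matrix.fromBlocks x 0 0 y) =
      max ((columnHilbert K).nrm x) ((columnHilbert K).nrm y) := by
  refine le_antisymm (columnHilbert_le (le_max_of_le_left (columnHilbert_nonneg x)) fun v => ?_)
    (max_le ?_ ?_)
  · simp only [Fintype.sum_sum_type, Matrix.fromBlocks_apply₁₁, Matrix.fromBlocks_apply₁₂,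
      Matrix.fromBlocks_apply₂₁, Matrix.fromBlocks_apply₂₂, Matrix.zero_apply, smul_zero,
      Finset.sum_const_zero, add_zero, zero_add, mul_add]
    refine add_le_add ((sum_norm_sq_smul_le_columnHilbert x _).trans ?_)
      ((sum_norm_sq_smul_le_columnHilbert y _).trans ?_)
    · gcongr
      exacts [columnHilbert_nonneg x, le_max_left _ _]
    · gcongr
      exacts [columnHilbert_nonneg y, le_max_right _ _]
  · refine columnHilbert_le (columnHilbert_nonneg _) fun v => ?_
    simpa using sum_norm_sq_smul_le_columnHilbert (Matrix.fromBlocks x 0 0 y) (Sum.elim v 0)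
  · refine columnHilbert_le (columnHilbert_nonneg _) fun v => ?_
    simpa using sum_norm_sq_smul_le_columnHilbert (Matrix.fromBlocks x 0 0 y) (Sum.elim 0 v)

theorem columnHilbert_bimul_le (α : Matrix p m ℂ) (x : Matrix m n K) (β : Matrix n q ℂ) :
    (columnHilbert K).nrm (Matrix.bimul α x β) ≤
      scalarOpNorm α * (columnHilbert K).nrm x * scalarOpNorm β := by
  have hα := scalarOpNorm_nonneg α
  have hβ := scalarOpNorm_nonneg β
  have hx := columnHilbert_nonneg x
  refine columnHilbert_le (by positivity) fun v => ?_
  have assoc (i) : ∑ j, v j • Matrix.bimul α x β i j =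
      ∑ k, α i k • ∑ l, (∑ j, β l j * v j) • x k l := by
    simp only [Matrix.bimul, Matrix.of_apply, Finset.smul_sum, Finset.sum_smul, smul_smul]
    rw [Finset.sum_comm]
    refine Finset.sum_congr rfl fun k _ => ?_
    rw [Finset.sum_comm]
    simp only [mul_left_comm, mul_comm]
  simp only [assoc]
  calc _ ≤ scalarOpNorm α ^ 2 * ∑ k, ‖∑ l, (∑ j, β l j * v j) • x k l‖ ^ 2 :=
        sum_norm_sq_smul_le α _
    _ ≤ scalarOpNorm α ^ 2 * ((columnHilbert K).nrm x ^ 2 * ∑ l, ‖∑ j, β l j * v j‖ ^ 2) := by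
        gcongr
        exact sum_norm_sq_smul_le_columnHilbert x _
    _ ≤ scalarOpNorm α ^ 2 * ((columnHilbert K).nrm x ^ 2 *
          (scalarOpNorm β ^ 2 * ∑ j, ‖v j‖ ^ 2)) := by
        gcongr
        exact sum_norm_sq_mul_le β v
    _ = _ := by ring

theorem columnHilbert_isOperatorSpace : (columnHilbert K).IsOperatorSpace where
  add_le := columnHilbert_add_le
  smul_eq := columnHilbert_smul
  eq_zero _ := eq_zero_of_columnHilbert_eq_zero
  directSum := columnHilbert_fromBlocks
  bimul_le := columnHilbert_bimul_le

theorem columnHilbert_eq_scalarOpNorm {ι : Type} [Fintype ι] {b : ι → K} (hb : Orthonormal ℂ b)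
    {x : Matrix m n K} {a : m → n → ι → ℂ} (hx : ∀ i j, x i j = ∑ k, a i j k • b k) :
    (columnHilbert K).nrm x = scalarOpNorm (Matrix.of fun (i : m × ι) (j : n) => a i.1 j i.2) := by
  have key (v : n → ℂ) :
      ∑ i, ‖∑ j, v j • x i j‖ ^ 2 = ∑ i : m × ι, ‖∑ j, a i.1 j i.2 * v j‖ ^ 2 := by
    rw [Fintype.sum_prod_type]
    refine Finset.sum_congr rfl fun i _ => ?_
    rw [← norm_sq_sum_smul_of_orthonormal hb]
    simp only [hx, Finset.sum_smul, Finset.smul_sum, smul_smul, mul_comm]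
    rw [Finset.sum_comm]
  refine le_antisymm (columnHilbert_le (scalarOpNorm_nonneg _) fun v => ?_)
    (scalarOpNorm_le (columnHilbert_nonneg x) fun v => ?_)
  · exact (key v).trans_le (sum_norm_sq_mul_le _ v)
  · exact (key v).symm.trans_le (sum_norm_sq_smul_le_columnHilbert x v)

theorem scalars_eq_columnHilbert : scalars = columnHilbert ℂ := by
  refine congrArg MatrixNorms.mk ?_
  funext m n _ _ A
  change scalarOpNorm A = (columnHilbert ℂ).nrm A
  refine le_antisymm (scalarOpNorm_le (columnHilbert_nonneg A) fun v => ?_)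
    (columnHilbert_le (scalarOpNorm_nonneg A) fun v => ?_)
  · simpa only [smul_eq_mul, mul_comm (v _)] using sum_norm_sq_smul_le_columnHilbert A v
  · simpa only [smul_eq_mul, mul_comm (v _)] using sum_norm_sq_mul_le A v

theorem scalars_isOperatorSpace : scalars.IsOperatorSpace :=
  scalars_eq_columnHilbert ▸ columnHilbert_isOperatorSpace

end ColumnHilbert

/-! ### Bimodular matrix norms -/

section Weak

variable {X : Type*} [AddCommGroup X] [Module ℂ X] {o : MatrixNorms X}
variable {m n p q : Type} [Fintype m] [Fintype n]

/-- Nonnegative matrix norms for which the scalar matrices act contractively. -/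
structure IsBimodular (o : MatrixNorms X) : Prop where
  nonneg : ∀ {m n : Type} [Fintype m] [Fintype n] (x : Matrix m n X), 0 ≤ o.nrm x
  bimul_le : ∀ {p m n q : Type} [Fintype p] [Fintype m] [Fintype n] [Fintype q]
    (α : Matrix p m ℂ) (x : Matrix m n X) (β : Matrix n q ℂ),
    o.nrm (Matrix.bimul α x β) ≤ scalarOpNorm α * o.nrm x * scalarOpNorm β

/-- The properties of operator spaces which do not involve sums of matrices. They suffice for the
estimates in `C₂(X)` and `C₂[X]` and, unlike the triangle inequality, they are elementary
for `H_o`. -/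
structure IsWeakOperatorSpace (o : MatrixNorms X) : Prop extends IsBimodular o where
  nrm_blockDiagonal_le : ∀ {ι m n : Type} [Fintype ι] [DecidableEq ι] [Fintype m] [Fintype n]
    (x : Matrix m n X), o.nrm (Matrix.blockDiagonal fun _ : ι => x) ≤ o.nrm x

theorem bimul_one_submatrix [DecidableEq m] [DecidableEq n] (x : Matrix m n X) (f : p → m)
    (g : q → n) :
    Matrix.bimul ((1 : Matrix m m ℂ).submatrix f id) x ((1 : Matrix n n ℂ).submatrix id g) =
      x.submatrix f g := by
  ext i j
  simp [Matrix.bimul, Matrix.one_apply]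

theorem bimul_transpose (α : Matrix p m ℂ) (x : Matrix m n X) (β : Matrix n q ℂ) :
    (Matrix.bimul α x β).transpose = Matrix.bimul β.transpose x.transpose α.transpose := by
  ext i j
  simp only [Matrix.bimul, Matrix.transpose_apply, Matrix.of_apply]
  rw [Finset.sum_comm]
  simp only [mul_comm]

variable [Fintype p] [Fintype q]

namespace IsBimodular

theorem nrm_submatrix_le (h : o.IsBimodular) (x : Matrix m n X) {f : p → m} {g : q → n}
    (hf : Function.Injective f) (hg : Function.Injective g) :
    o.nrm (x.submatrix f g) ≤ o.nrm x := by
  classical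
  have hx := h.nonneg x
  have hβ := scalarOpNorm_nonneg ((1 : Matrix n n ℂ).submatrix id g)
  rw [← bimul_one_submatrix]
  calc _ ≤ _ := h.bimul_le _ x _
    _ ≤ 1 * o.nrm x * 1 := by
        gcongr
        exacts [scalarOpNorm_one_submatrix_left_le hf, scalarOpNorm_one_submatrix_right_le hg]
    _ = o.nrm x := by ring

theorem nrm_submatrix_equiv (h : o.IsBimodular) (x : Matrix m n X) (e : p ≃ m) (f : q ≃ n) :
    o.nrm (x.submatrix e f) = o.nrm x := by
  refine (h.nrm_submatrix_le x e.injective f.injective).antisymm ?_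
  simpa using h.nrm_submatrix_le (x.submatrix e f) e.symm.injective f.symm.injective

end IsBimodular

namespace IsOperatorSpace

theorem nrm_zero (h : o.IsOperatorSpace) : o.nrm (0 : Matrix m n X) = 0 := by
  simpa using h.smul_eq 0 (0 : Matrix m n X)

theorem isBimodular (h : o.IsOperatorSpace) : o.IsBimodular where
  nonneg x := by
    have hx := h.add_le x ((-1 : ℂ) • x)
    rw [h.smul_eq, neg_smul, one_smul, add_neg_cancel, h.nrm_zero, norm_neg, norm_one, one_mul]
      at hx
    linarith
  bimul_le := h.bimul_le

theorem nrm_blockDiagonal_fin_le (h : o.IsOperatorSpace) {C : ℝ} (hC : 0 ≤ C) (k : ℕ)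
    (M : Fin k → Matrix m n X) (hM : ∀ i, o.nrm (M i) ≤ C) :
    o.nrm (Matrix.blockDiagonal M) ≤ C := by
  induction k with
  | zero =>
    rw [Subsingleton.elim (Matrix.blockDiagonal M) 0, h.nrm_zero]
    exact hC
  | succ k ih =>
    let f (l : Type) : l × Fin (k + 1) → l ⊕ l × Fin k := fun a =>
      Fin.cases (motive := fun _ => l ⊕ l × Fin k) (Sum.inl a.1) (fun b => Sum.inr (a.1, b)) a.2
    have hf (l) : Function.Injective (f l) := by
      rintro ⟨a, b⟩ ⟨a', b'⟩ hab
      induction b using Fin.cases <;> induction b' using Fin.cases <;> simp_all [f]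
    have split : Matrix.blockDiagonal M = (Matrix.fromBlocks (M 0) 0 0
        (Matrix.blockDiagonal fun i => M i.succ)).submatrix (f m) (f n) := by
      ext ⟨a, b⟩ ⟨a', b'⟩
      induction b using Fin.cases <;> induction b' using Fin.cases <;>
        simp [f, Matrix.blockDiagonal_apply, Fin.succ_ne_zero, (Fin.succ_ne_zero _).symm]
    rw [split]
    refine (h.isBimodular.nrm_submatrix_le _ (hf m) (hf n)).trans ?_
    rw [h.directSum]
    exact max_le (hM 0) (ih _ fun i => hM i.succ)

theorem nrm_blockDiagonal_le (h : o.IsOperatorSpace) {ι : Type} [Fintype ι] [DecidableEq ι]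
    {C : ℝ} (hC : 0 ≤ C) {M : ι → Matrix m n X} (hM : ∀ i, o.nrm (M i) ≤ C) :
    o.nrm (Matrix.blockDiagonal M) ≤ C := by
  let e := Fintype.equivFin ι
  have reindex : Matrix.blockDiagonal M = (Matrix.blockDiagonal fun i => M (e.symm i)).submatrix
      ((Equiv.refl m).prodCongr e) ((Equiv.refl n).prodCongr e) := by
    ext ⟨a, b⟩ ⟨a', b'⟩
    simp [Matrix.blockDiagonal_apply]
  rw [reindex, h.isBimodular.nrm_submatrix_equiv]
  exact h.nrm_blockDiagonal_fin_le hC _ _ fun i => hM _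

theorem isWeakOperatorSpace (h : o.IsOperatorSpace) : o.IsWeakOperatorSpace where
  toIsBimodular := h.isBimodular
  nrm_blockDiagonal_le x := h.nrm_blockDiagonal_le (h.isBimodular.nonneg x) fun _ => le_rfl

end IsOperatorSpace

theorem scalars_isWeakOperatorSpace : scalars.IsWeakOperatorSpace :=
  scalars_isOperatorSpace.isWeakOperatorSpace

theorem scalarOpNorm_submatrix_le (A : Matrix m n ℂ) {f : p → m} {g : q → n}
    (hf : Function.Injective f) (hg : Function.Injective g) :
    scalarOpNorm (A.submatrix f g) ≤ scalarOpNorm A :=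
  scalars_isWeakOperatorSpace.nrm_submatrix_le A hf hg

end Weak

/-! ### Transposition -/

section Op

/-- The opposite matrix norms, by which statements on rows and on right projections become
statements on columns and on left projections. -/
def op {X : Type*} (o : MatrixNorms X) : MatrixNorms X where
  nrm x := o.nrm x.transpose

/-- The set whose infimum is the projective tensor norm `(proj oX oY).nrm u`. -/
def projCosts {X Y : Type*} [AddCommGroup X] [Module ℂ X] [AddCommGroup Y] [Module ℂ Y]
    (oX : MatrixNorms X) (oY : MatrixNorms Y) {m n : Type} [Fintype m] [Fintype n]
    (u : Matrix m n (X ⊗[ℂ] Y)) : Set ℝ :=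
  {t : ℝ | ∃ (p q r s : ℕ) (α : Matrix m (Fin p × Fin r) ℂ)
    (x : Matrix (Fin p) (Fin q) X) (y : Matrix (Fin r) (Fin s) Y)
    (β : Matrix (Fin q × Fin s) n ℂ),
    u = Matrix.bimul α (Matrix.tensorMat x y) β ∧
      t = scalarOpNorm α * oX.nrm x * oY.nrm y * scalarOpNorm β}

variable {X Y : Type*} [AddCommGroup X] [Module ℂ X] [AddCommGroup Y] [Module ℂ Y]
variable {m n : Type} [Fintype m] [Fintype n]

theorem projCosts_subset_op (oX : MatrixNorms X) (oY : MatrixNorms Y)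
    (u : Matrix m n (X ⊗[ℂ] Y)) : projCosts oX oY u ⊆ projCosts oX.op oY.op u.transpose := by
  rintro _ ⟨p, q, r, s, α, x, y, β, hu, rfl⟩
  refine ⟨q, p, s, r, β.transpose, x.transpose, y.transpose, α.transpose, ?_, ?_⟩
  · rw [hu, bimul_transpose]
    rfl
  · rw [scalarOpNorm_transpose, scalarOpNorm_transpose]
    simp only [op, Matrix.transpose_transpose]
    ring

theorem op_proj (oX : MatrixNorms X) (oY : MatrixNorms Y) :
    (proj oX oY).op = proj oX.op oY.op :=
  congrArg MatrixNorms.mk <| by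
    funext m n _ _ u
    exact congrArg sInf ((projCosts_subset_op oX oY u.transpose).antisymm
      (projCosts_subset_op oX.op oY.op u))

theorem op_scalars : scalars.op = scalars :=
  congrArg MatrixNorms.mk <| by
    funext m n _ _ A
    exact scalarOpNorm_transpose A

theorem op_colProj (o : MatrixNorms X) : o.colProj.op = o.op.rowProj := by
  have h : (proj (col scalars) o).op = proj (row scalars) o.op := by
    rw [op_proj, show (col scalars).op = row scalars.op from rfl, op_scalars]
  exact congrArg (fun t => MatrixNorms.mk fun x => t.nrm (x.map toTensor)) h

theorem IsOperatorSpace.op {o : MatrixNorms X} (h : o.IsOperatorSpace) : o.op.IsOperatorSpace where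
  add_le x y := h.add_le x.transpose y.transpose
  smul_eq c x := h.smul_eq c x.transpose
  eq_zero x hx := Matrix.transpose_injective (h.eq_zero _ hx)
  directSum x y := by
    change o.nrm (Matrix.fromBlocks x 0 0 y).transpose = _
    rw [Matrix.fromBlocks_transpose, Matrix.transpose_zero, Matrix.transpose_zero]
    exact h.directSum _ _
  bimul_le α x β := by
    change o.nrm (Matrix.bimul α x β).transpose ≤ _
    rw [bimul_transpose]
    refine (h.bimul_le _ _ _).trans_eq ?_
    rw [scalarOpNorm_transpose, scalarOpNorm_transpose, mul_comm, mul_comm (scalarOpNorm β),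
      ← mul_assoc]
    rfl

end Op

/-! ### The spaces `C₂[X]` -/

section ColProj

variable {X : Type*} [AddCommGroup X] [Module ℂ X] {o : MatrixNorms X}
variable {m n s : Type} [Fintype s]

/-- The factorization `v = (e ⊗ y) β` over `C₂ ⊗ X`, where `e = [e₀, e₁]` is the row of the unit
vectors of `C₂`. The norm of `C₂[X]` is the infimum of `‖y‖ ‖β‖` over these factorizations. -/
def IsColFactorization (v : Matrix m n (Fin 2 → X)) (y : Matrix m s X)
    (β : Matrix (Fin 2 × s) n ℂ) : Prop :=
  ∀ i j k, v i j k = ∑ l, β (k, l) j • y i l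

theorem isColFactorization_self [Fintype n] [DecidableEq n] (v : Matrix m n (Fin 2 → X)) :
    IsColFactorization v (Matrix.of fun i (j : n × Fin 2) => v i j.1 j.2)
      (Matrix.of fun l j => if l.2.1 = j ∧ l.2.2 = l.1 then 1 else 0) := fun i j k => by
  simp [Fintype.sum_prod_type, ite_and]

theorem apply_eq_of_map_toTensor_eq {p q r s : Type} [Fintype p] [Fintype q] [Fintype r]
    [Fintype s] {v : Matrix m n (Fin 2 → X)} {α : Matrix m (p × r) ℂ}
    {x : Matrix p q (Fin 2 → ℂ)} {y : Matrix r s X} {β : Matrix (q × s) n ℂ}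
    (h : v.map toTensor = Matrix.bimul α (Matrix.tensorMat x y) β) (i : m) (j : n) (k : Fin 2) :
    v i j k = ∑ a, ∑ b, (α i a * β b j) • x a.1 b.1 k • y a.2 b.2 := by
  let coord : (Fin 2 → ℂ) ⊗[ℂ] X →ₗ[ℂ] X :=
    TensorProduct.lift (LinearMap.lsmul ℂ X ∘ₗ LinearMap.proj k)
  have coord_toTensor (w : Fin 2 → X) : coord (toTensor w) = w k := by
    fin_cases k <;> simp [coord, toTensor]
  have hk := congrArg (fun u => coord (u i j)) h
  simpa [coord_toTensor, Matrix.bimul, Matrix.tensorMat, coord] using hk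

variable [Fintype m] [Fintype n]

theorem IsColFactorization.exists_mem_projCosts_le (ho : o.IsBimodular)
    {v : Matrix m n (Fin 2 → X)} {y : Matrix m s X} {β : Matrix (Fin 2 × s) n ℂ}
    (hv : IsColFactorization v y β) :
    ∃ t ∈ projCosts (col scalars) o (v.map toTensor), t ≤ o.nrm y * scalarOpNorm β := by
  classical
  let em := Fintype.equivFin m
  let es := Fintype.equivFin s
  let f : m → Fin 1 × Fin (Fintype.card m) := fun i => (0, em i)
  have hf : Function.Injective f := fun a b hab => em.injective (Prod.ext_iff.1 hab).2
  let α := (1 : Matrix (Fin 1 × Fin (Fintype.card m)) (Fin 1 × Fin (Fintype.card m)) ℂ).submatrix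
    f id
  let e : Matrix (Fin 1) (Fin 2) (Fin 2 → ℂ) := Matrix.of fun _ k => Pi.single k 1
  let y' := y.submatrix em.symm es.symm
  let β' := β.submatrix (Prod.map id es.symm : Fin 2 × Fin (Fintype.card s) → Fin 2 × s) id
  have nrm_e : (col scalars).nrm e ≤ 1 := scalarOpNorm_le zero_le_one fun v => by
    simp [e, Fintype.sum_prod_type, Pi.single_apply]
  have nrm_y' : o.nrm y' ≤ o.nrm y :=
    ho.nrm_submatrix_le _ em.symm.injective es.symm.injective
  have nrm_β' : scalarOpNorm β' ≤ scalarOpNorm β := scalarOpNorm_submatrix_le _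
    (Function.injective_id.prodMap es.symm.injective) Function.injective_id
  refine ⟨_, ⟨1, 2, _, _, α, e, y', β', ?_, rfl⟩, ?_⟩
  · have sum_eq (i j k) : ∑ l, β' (k, l) j • y' (em i) l = v i j k := by
      rw [hv]
      simp only [β', y', Matrix.submatrix_apply, Prod.map_apply, id_eq, Equiv.symm_apply_apply]
      exact Equiv.sum_comp es.symm fun l => β (k, l) j • y i l
    ext i j
    simp only [Matrix.map_apply, toTensor, Matrix.bimul, α, Matrix.submatrix_apply, id_eq,
      Matrix.one_apply, Matrix.of_apply, f, Matrix.tensorMat, ite_mul, one_mul, zero_mul, ite_smul,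
      zero_smul, Finset.sum_ite_irrel, Finset.sum_const_zero, Finset.sum_ite_eq, Finset.mem_univ,
      if_true, Fintype.sum_prod_type (α₁ := Fin 2), e, ← TensorProduct.tmul_smul,
      ← TensorProduct.tmul_sum, sum_eq]
  · have := ho.nonneg y
    have := ho.nonneg y'
    have := scalarOpNorm_nonneg β'
    have : 0 ≤ (col scalars).nrm e := scalarOpNorm_nonneg _
    calc _ ≤ 1 * 1 * o.nrm y * scalarOpNorm β := by
          gcongr
          exact scalarOpNorm_one_submatrix_left_le hf
      _ = _ := by ring

theorem colProj_le (ho : o.IsBimodular) {v : Matrix m n (Fin 2 → X)} {y : Matrix m s X}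
    {β : Matrix (Fin 2 × s) n ℂ} (hv : IsColFactorization v y β) :
    o.colProj.nrm v ≤ o.nrm y * scalarOpNorm β := by
  obtain ⟨t, ht, hle⟩ := hv.exists_mem_projCosts_le ho
  refine (csInf_le ⟨0, ?_⟩ ht).trans hle
  rintro _ ⟨p, q, r, s, α, x, y, β, -, rfl⟩
  have := scalarOpNorm_nonneg α
  have := scalarOpNorm_nonneg β
  have := ho.nonneg y
  have : 0 ≤ (col scalars).nrm x := scalarOpNorm_nonneg _
  positivity

theorem IsWeakOperatorSpace.nrm_mul_blockDiagonal_le {r p : Type} [Fintype r] [Fintype p]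
    (ho : o.IsWeakOperatorSpace) (α : Matrix m (p × r) ℂ) (y : Matrix r s X) :
    o.nrm (Matrix.of fun i (l : s × p) => ∑ b, α i (l.2, b) • y b l.1) ≤
      scalarOpNorm α * o.nrm y := by
  classical
  have factor : (Matrix.of fun i (l : s × p) => ∑ b, α i (l.2, b) • y b l.1) =
      Matrix.bimul (α.submatrix id Prod.swap) (Matrix.blockDiagonal fun _ : p => y)
        ((1 : Matrix (s × p) (s × p) ℂ).submatrix id id) := by
    ext i ⟨d, a⟩
    simp [Matrix.bimul, Matrix.blockDiagonal_apply, Matrix.one_apply, Fintype.sum_prod_type,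
      ite_and]
  have := scalarOpNorm_nonneg α
  rw [factor]
  calc _ ≤ _ := ho.bimul_le _ _ _
    _ ≤ scalarOpNorm α * o.nrm y * 1 := by
        gcongr
        · exact scalarOpNorm_nonneg _
        · exact mul_nonneg this (ho.nonneg y)
        · exact ho.nonneg _
        · exact scalarOpNorm_submatrix_le α Function.injective_id Prod.swap_injective
        · exact ho.nrm_blockDiagonal_le y
        · exact scalarOpNorm_one_submatrix_right_le Function.injective_id
    _ = _ := mul_one _

theorem exists_isColFactorization_of_mem_projCosts (ho : o.IsWeakOperatorSpace)
    {v : Matrix m n (Fin 2 → X)} {t : ℝ} (ht : t ∈ projCosts (col scalars) o (v.map toTensor)) :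
    ∃ (s : Type) (_ : Fintype s) (y : Matrix m s X) (β : Matrix (Fin 2 × s) n ℂ),
      IsColFactorization v y β ∧ o.nrm y * scalarOpNorm β ≤ t := by
  obtain ⟨p, q, r, s, α, x, y, β, huv, rfl⟩ := ht
  let x' : Matrix (Fin p × Fin 2) (Fin q) ℂ := Matrix.of fun i c => x i.1 c i.2
  let y' : Matrix m (Fin s × Fin p) X := Matrix.of fun i l => ∑ b, α i (l.2, b) • y b l.1
  let β' : Matrix (Fin 2 × Fin s × Fin p) n ℂ := Matrix.of fun l j =>
    ∑ c, β (c, l.2.1) j * x l.2.2 c l.1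
  have nrm_y' : o.nrm y' ≤ scalarOpNorm α * o.nrm y := ho.nrm_mul_blockDiagonal_le α y
  have nrm_β' : scalarOpNorm β' ≤ (col scalars).nrm x * scalarOpNorm β := by
    let swap : Fin 2 × Fin s × Fin p → (Fin p × Fin 2) × Fin s := fun l => ((l.2.2, l.1), l.2.1)
    have swap_injective : Function.Injective swap := fun a b h => by
      simp only [swap, Prod.mk.injEq] at h
      exact Prod.ext h.1.2 (Prod.ext h.2 h.1.1)
    rw [← scalarOpNorm_transpose β']
    calc _ ≤ _ := scalarOpNorm_submatrix_le (Matrix.of fun j (l : (Fin p × Fin 2) × Fin s) =>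
          ∑ c, β.transpose.submatrix id Prod.swap j (l.2, c) • x'.transpose c l.1)
          Function.injective_id swap_injective
      _ ≤ _ := scalars_isWeakOperatorSpace.nrm_mul_blockDiagonal_le _ _
      _ ≤ scalarOpNorm β.transpose * scalarOpNorm x'.transpose := by
          refine mul_le_mul_of_nonneg_right ?_ (scalarOpNorm_nonneg _)
          exact scalarOpNorm_submatrix_le _ Function.injective_id Prod.swap_injective
      _ = _ := by rw [scalarOpNorm_transpose, scalarOpNorm_transpose, mul_comm]; rfl
  refine ⟨Fin s × Fin p, inferInstance, y', β', fun i j k => ?_, ?_⟩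
  · rw [apply_eq_of_map_toTensor_eq huv i j k]
    simp only [Fintype.sum_prod_type, y', β', Matrix.of_apply, Finset.sum_smul, Finset.smul_sum,
      Finset.sum_comm (s := (Finset.univ : Finset (Fin q)))
      (t := (Finset.univ : Finset (Fin s)))]
    rw [Finset.sum_comm_cycle]
    simp only [smul_smul, mul_comm, mul_left_comm]
  · calc o.nrm y' * scalarOpNorm β'
      _ ≤ (scalarOpNorm α * o.nrm y) * ((col scalars).nrm x * scalarOpNorm β) :=
          mul_le_mul nrm_y' nrm_β' (scalarOpNorm_nonneg _)
            (mul_nonneg (scalarOpNorm_nonneg _) (ho.nonneg _))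
      _ = _ := by ring

theorem le_colProj (ho : o.IsWeakOperatorSpace) {v : Matrix m n (Fin 2 → X)} {C : ℝ}
    (h : ∀ (s : Type) [Fintype s] (y : Matrix m s X) (β : Matrix (Fin 2 × s) n ℂ),
      IsColFactorization v y β → C ≤ o.nrm y * scalarOpNorm β) :
    C ≤ o.colProj.nrm v := by
  classical
  obtain ⟨t, ht, -⟩ := (isColFactorization_self v).exists_mem_projCosts_le ho.toIsBimodular
  refine le_csInf ⟨t, ht⟩ fun t ht => ?_
  obtain ⟨s, _, y, β, hv, hle⟩ := exists_isColFactorization_of_mem_projCosts ho ht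
  exact (h s y β hv).trans hle

end ColProj

section ColProjBounds

variable {X Y : Type*} [AddCommGroup X] [Module ℂ X] [AddCommGroup Y] [Module ℂ Y]
variable {o : MatrixNorms X} {oY : MatrixNorms Y}
variable {m n p q : Type} [Fintype m] [Fintype n] [Fintype p] [Fintype q]

theorem nrm_sum_le_colProj (ho : o.IsWeakOperatorSpace) (hY : oY.IsBimodular)
    (T : Fin 2 → X →ₗ[ℂ] Y) {C : ℝ} (hC : 0 < C)
    (hT : ∀ (s : Type) [Fintype s] (y : Matrix m s X),
      oY.nrm (Matrix.of fun i (l : Fin 2 × s) => T l.1 (y i l.2)) ≤ C * o.nrm y)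
    (v : Matrix m n (Fin 2 → X)) :
    oY.nrm (Matrix.of fun i j => ∑ k, T k (v i j k)) ≤ C * o.colProj.nrm v := by
  classical
  rw [← div_le_iff₀' hC]
  refine le_colProj ho fun s _ y β hv => ?_
  have factor : (Matrix.of fun i j => ∑ k, T k (v i j k)) =
      Matrix.bimul ((1 : Matrix m m ℂ).submatrix id id)
        (Matrix.of fun i (l : Fin 2 × s) => T l.1 (y i l.2)) β := by
    ext i j
    simp [Matrix.bimul, Matrix.one_apply, hv i j, Fintype.sum_prod_type]
  have := hY.nonneg (Matrix.of fun i (l : Fin 2 × s) => T l.1 (y i l.2))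
  have := scalarOpNorm_nonneg β
  rw [div_le_iff₀' hC, factor, ← mul_assoc]
  calc _ ≤ _ := hY.bimul_le _ _ _
    _ ≤ 1 * (C * o.nrm y) * scalarOpNorm β := by
        gcongr
        exacts [scalarOpNorm_one_submatrix_left_le Function.injective_id, hT s y]
    _ = _ := by rw [one_mul]

theorem nrm_apply_le_colProj (ho : o.IsWeakOperatorSpace) (v : Matrix m n (Fin 2 → X))
    (k : Fin 2) : o.nrm (v.map fun w => w k) ≤ o.colProj.nrm v := by
  classical
  refine le_colProj ho fun s _ y β hv => ?_
  have factor : (v.map fun w => w k) =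
      Matrix.bimul ((1 : Matrix m m ℂ).submatrix id id) y (β.submatrix (Prod.mk k) id) := by
    ext i j
    simp [Matrix.bimul, Matrix.one_apply, hv i j k]
  have := ho.nonneg y
  have := scalarOpNorm_nonneg (β.submatrix (Prod.mk k) id)
  rw [factor]
  calc _ ≤ _ := ho.bimul_le _ _ _
    _ ≤ 1 * o.nrm y * scalarOpNorm β := by
        gcongr
        · exact scalarOpNorm_one_submatrix_left_le Function.injective_id
        · exact scalarOpNorm_submatrix_le β (Prod.mk_right_injective k) Function.injective_id
    _ = _ := by rw [one_mul]

theorem colProj_single_le (ho : o.IsBimodular) (x : Matrix m n X) (k : Fin 2) :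
    o.colProj.nrm (x.map fun ξ => (Pi.single k ξ : Fin 2 → X)) ≤ o.nrm x := by
  classical
  have hx : IsColFactorization (x.map fun ξ => (Pi.single k ξ : Fin 2 → X)) x
      ((1 : Matrix (Fin 2 × n) (Fin 2 × n) ℂ).submatrix id (Prod.mk k)) := fun i j k' => by
    simp [Matrix.one_apply, Pi.single_apply, ite_and]
  refine (colProj_le ho hx).trans (mul_le_of_le_one_right (ho.nonneg x) ?_)
  exact scalarOpNorm_one_submatrix_right_le (Prod.mk_right_injective k)

theorem colProj_submatrix_le (ho : o.IsWeakOperatorSpace) (v : Matrix m n (Fin 2 → X))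
    {f : p → m} {g : q → n} (hf : Function.Injective f) (hg : Function.Injective g) :
    o.colProj.nrm (v.submatrix f g) ≤ o.colProj.nrm v := by
  refine le_colProj ho fun s _ y β hv => ?_
  have hv' : IsColFactorization (v.submatrix f g) (y.submatrix f id) (β.submatrix id g) :=
    fun i j k => hv (f i) (g j) k
  refine (colProj_le ho.toIsBimodular hv').trans ?_
  gcongr
  · exact scalarOpNorm_nonneg _
  · exact ho.nonneg y
  · exact ho.nrm_submatrix_le y hf Function.injective_id
  · exact scalarOpNorm_submatrix_le β Function.injective_id hg

end ColProjBounds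

/-! ### One-sided projections -/

section Projections

variable {X : Type*} [AddCommGroup X] [Module ℂ X]

/-- The idempotents `P` for which `x ↦ (P x, x - P x)` is an isometry into the space of pairs with
the matrix norms `c`. For `c = o.col` and `c = o.colProj` they are the left `M`- and
`L`-projections. -/
def splitProj (o : MatrixNorms X) (c : MatrixNorms (Fin 2 → X)) : Set (X →ₗ[ℂ] X) :=
  {P | P ∘ₗ P = P ∧ ∀ x, o.one x = c.one (splitMap P x)}

/-- The idempotents `P` for which `x ↦ (P x, x - P x)` is a complete isometry into the space of
pairs with the matrix norms `c`. -/
def completeSplitProj (o : MatrixNorms X) (c : MatrixNorms (Fin 2 → X)) : Set (X →ₗ[ℂ] X) :=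
  {P | P ∘ₗ P = P ∧ IsCompleteIsometry o c (splitMap P)}

/-- The common properties of `c = C₂(X)` and `c = C₂[X]`: coordinate projections and inclusions
are completely contractive, and the norms do not depend on the labelling of rows and columns. -/
structure IsTwofoldSum (o : MatrixNorms X) (c : MatrixNorms (Fin 2 → X)) : Prop
    extends o.IsBimodular where
  nrm_apply_le : ∀ {m n : Type} [Fintype m] [Fintype n] (v : Matrix m n (Fin 2 → X)) (k : Fin 2),
    o.nrm (v.map fun w => w k) ≤ c.nrm v
  nrm_single_le : ∀ {m n : Type} [Fintype m] [Fintype n] (x : Matrix m n X) (k : Fin 2),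
    c.nrm (x.map fun ξ => (Pi.single k ξ : Fin 2 → X)) ≤ o.nrm x
  nrm_submatrix_le : ∀ {m n p q : Type} [Fintype m] [Fintype n] [Fintype p] [Fintype q]
    (v : Matrix m n (Fin 2 → X)) (e : p ≃ m) (f : q ≃ n), c.nrm (v.submatrix e f) ≤ c.nrm v

variable {o : MatrixNorms X} {c : MatrixNorms (Fin 2 → X)}

theorem IsBimodular.isTwofoldSum_col (h : o.IsBimodular) : IsTwofoldSum o o.col where
  toIsBimodular := h
  nrm_apply_le {m n} _ _ v k :=
    h.nrm_submatrix_le (Matrix.of fun (i : m × Fin 2) (j : n) => v i.1 j i.2)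
      (f := fun i => (i, k)) (Prod.mk_left_injective k) Function.injective_id
  nrm_single_le {m n} _ _ x k := by
    classical
    have factor :
        (Matrix.of fun (i : m × Fin 2) (j : n) => (Pi.single k (x i.1 j) : Fin 2 → X) i.2) =
          Matrix.bimul ((1 : Matrix (m × Fin 2) (m × Fin 2) ℂ).submatrix id fun i => (i, k)) x
            ((1 : Matrix n n ℂ).submatrix id id) := by
      ext ⟨i, k'⟩ j
      simp [Matrix.bimul, Matrix.one_apply, Pi.single_apply, ite_and]
    have := h.nonneg x
    calc _ = _ := congrArg o.nrm factor
      _ ≤ _ := h.bimul_le _ _ _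
      _ ≤ 1 * o.nrm x * 1 := by
          gcongr
          · exact scalarOpNorm_nonneg _
          · exact scalarOpNorm_one_submatrix_right_le (Prod.mk_left_injective k)
          · exact scalarOpNorm_one_submatrix_right_le Function.injective_id
      _ = o.nrm x := by ring
  nrm_submatrix_le {m n p q} _ _ _ _ v e f :=
    h.nrm_submatrix_le (Matrix.of fun (i : m × Fin 2) (j : n) => v i.1 j i.2)
      (e.injective.prodMap Function.injective_id) f.injective

theorem IsWeakOperatorSpace.isTwofoldSum_colProj (h : o.IsWeakOperatorSpace) :
    IsTwofoldSum o o.colProj where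
  toIsBimodular := h.toIsBimodular
  nrm_apply_le := nrm_apply_le_colProj h
  nrm_single_le := colProj_single_le h.toIsBimodular
  nrm_submatrix_le v e f := colProj_submatrix_le h v e.injective f.injective

theorem IsBimodular.completeLeftM_eq (h : o.IsBimodular) :
    o.completeLeftM = completeSplitProj o o.col := by
  have amplify_col (P : X →ₗ[ℂ] X) (n : ℕ) (x : Matrix (Fin n) (Fin n) X) :
      (o.amplify n).col.one (splitMap P.mapMatrix x) = o.col.nrm (x.map (splitMap P)) := by
    let e : (Unit × Fin 2) × Fin n ≃ Fin n × Fin 2 :=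
      ((Equiv.punitProd _).prodCongr (Equiv.refl _)).trans (Equiv.prodComm _ _)
    refine Eq.trans (congrArg o.nrm ?_) (h.nrm_submatrix_equiv
      (Matrix.of fun (i : Fin n × Fin 2) (j : Fin n) => splitMap P (x i.1 j) i.2) e
      (Equiv.punitProd _))
    ext ⟨⟨_, k⟩, i⟩ ⟨_, j⟩
    fin_cases k <;> rfl
  have amplify_one (n : ℕ) (x : Matrix (Fin n) (Fin n) X) : (o.amplify n).one x = o.nrm x :=
    h.nrm_submatrix_equiv x (Equiv.punitProd _) (Equiv.punitProd _)
  ext P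
  simp only [completeLeftM, leftM, completeSplitProj, IsCompleteIsometry, Set.mem_ofPred_eq,
    amplify_col, amplify_one, forall_and]
  refine and_congr ⟨fun hP => ?_, fun hP n => ?_⟩ (by simp only [eq_comm])
  · ext x
    exact congrFun₂ (LinearMap.congr_fun (hP 1) (Matrix.of fun _ _ => x)) 0 0
  · ext x i j
    exact LinearMap.congr_fun hP (x i j)

namespace IsTwofoldSum

theorem nrm_single (h : IsTwofoldSum o c) {m n : Type} [Fintype m] [Fintype n] (x : Matrix m n X)
    (k : Fin 2) : c.nrm (x.map fun ξ => (Pi.single k ξ : Fin 2 → X)) = o.nrm x := by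
  refine (h.nrm_single_le x k).antisymm (le_of_eq_of_le (congrArg o.nrm ?_)
    (h.nrm_apply_le (x.map fun ξ => (Pi.single k ξ : Fin 2 → X)) k))
  ext i j
  simp

theorem zero_mem_completeSplitProj (h : IsTwofoldSum o c) : 0 ∈ completeSplitProj o c := by
  have splitMap_zero :
      splitMap (0 : X →ₗ[ℂ] X) = fun ξ => (Pi.single 1 ξ : Fin 2 → X) := by
    funext x k
    fin_cases k <;> simp [splitMap]
  refine ⟨LinearMap.zero_comp 0, fun n x => ?_⟩
  rw [splitMap_zero]
  exact h.nrm_single x 1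

theorem id_mem_completeSplitProj (h : IsTwofoldSum o c) :
    LinearMap.id ∈ completeSplitProj o c := by
  have splitMap_id :
      splitMap (LinearMap.id : X →ₗ[ℂ] X) = fun ξ => (Pi.single 0 ξ : Fin 2 → X) := by
    funext x k
    fin_cases k <;> simp [splitMap]
  refine ⟨LinearMap.id_comp LinearMap.id, fun n x => ?_⟩
  rw [splitMap_id]
  exact h.nrm_single x 0

theorem completeSplitProj_subset_splitProj (h : IsTwofoldSum o c) :
    completeSplitProj o c ⊆ splitProj o c := by
  rintro P ⟨hP, hx⟩
  let e : Unit ≃ Fin 1 := Equiv.ofUnique _ _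
  refine ⟨hP, fun x => ?_⟩
  have hc : c.one (splitMap P x) = c.nrm (Matrix.of fun (_ _ : Fin 1) => splitMap P x) :=
    (h.nrm_submatrix_le (Matrix.of fun _ _ => splitMap P x) e e).antisymm
      (h.nrm_submatrix_le (Matrix.of fun _ _ => splitMap P x) e.symm e.symm)
  have ho : o.one x = o.nrm (Matrix.of fun (_ _ : Fin 1) => x) :=
    h.nrm_submatrix_equiv (Matrix.of fun _ _ => x) e e
  rw [hc, ho]
  exact (hx 1 (Matrix.of fun _ _ => x)).symm

end IsTwofoldSum

end Projections

section OpProjections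

variable {X : Type*} [AddCommGroup X] [Module ℂ X] (o : MatrixNorms X)

theorem op_leftM : o.op.leftM = o.rightM := rfl

theorem op_colProj_op : o.op.colProj.op = o.rowProj := op_colProj o.op

theorem op_leftL : o.op.leftL = o.rightL := by
  ext P
  refine and_congr_right fun _ => forall_congr' fun x => ?_
  rw [← op_colProj_op]
  rfl

theorem op_completeLeftM : o.op.completeLeftM = o.completeRightM := by
  ext P
  refine forall_congr' fun n => and_congr_right fun _ => ?_
  have transpose_col (x : Matrix (Fin n) (Fin n) X) :
      (o.op.amplify n).col.one (splitMap P.mapMatrix x) =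
        (o.amplify n).row.one (splitMap P.mapMatrix x.transpose) := by
    refine congrArg o.nrm ?_
    ext ⟨i, a⟩ ⟨⟨j, k⟩, b⟩
    fin_cases k <;> rfl
  exact ⟨fun h x => (h x.transpose).trans (transpose_col x.transpose),
    fun h x => (h x.transpose).trans (transpose_col x).symm⟩

theorem op_completeLeftL : o.op.completeLeftL = o.completeRightL := by
  ext P
  refine and_congr_right fun _ => forall_congr' fun n => ?_
  rw [← op_colProj_op]
  exact ⟨fun h x => h x.transpose, fun h x => h x.transpose⟩

end OpProjections

/-! ### Orthogonal projections -/

section Orthogonal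

variable {H : Type*} [NormedAddCommGroup H] [InnerProductSpace ℂ H]

theorem norm_sq_smul_add_smul_of_orthonormal {u v : H} (h : Orthonormal ℂ ![u, v]) (a b : ℂ) :
    ‖a • u + b • v‖ ^ 2 = ‖a‖ ^ 2 + ‖b‖ ^ 2 := by
  simpa [Fin.sum_univ_two] using norm_sq_sum_smul_of_orthonormal h ![a, b]

theorem norm_add_of_orthonormal {u v : H} (h : Orthonormal ℂ ![u, v]) : ‖u + v‖ = √2 := by
  have := norm_sq_smul_add_smul_of_orthonormal h 1 1
  rw [one_smul, one_smul, norm_one, one_pow, one_add_one_eq_two] at this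
  rw [← this, Real.sqrt_sq (norm_nonneg _)]

theorem isSymmetricProjection_of_norm_apply_le {P : H →ₗ[ℂ] H} (hP : IsIdempotentElem P)
    (hle : ∀ x, ‖P x‖ ≤ ‖x‖) : P.IsSymmetricProjection := by
  refine ⟨hP, (LinearMap.IsIdempotentElem.isSymmetric_iff_isOrtho_range_ker hP).2 ?_⟩
  rw [Submodule.isOrtho_iff_inner_eq]
  rintro _ ⟨x, rfl⟩ w hw
  have hPP : P (P x) = P x := LinearMap.congr_fun hP x
  have closest : ‖P x - 0‖ = ⨅ w : P.ker, ‖P x - w‖ := by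
    refine le_antisymm (le_ciInf fun w => ?_)
      (ciInf_le ⟨0, Set.forall_mem_range.2 fun _ => norm_nonneg _⟩ (0 : P.ker))
    calc ‖P x - 0‖ = ‖P (P x - w)‖ := by rw [map_sub, LinearMap.mem_ker.1 w.2, hPP]
      _ ≤ ‖P x - w‖ := hle _
  simpa using (Submodule.norm_eq_iInf_iff_inner_eq_zero P.ker P.ker.zero_mem).1 closest w hw

theorem splitMap_add_of_apply_eq {P : H →ₗ[ℂ] H} {u v : H} (hu : P u = u) (hv : P v = 0) :
    splitMap P (u + v) = ![u, v] := by
  simp [splitMap, hu, hv]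

variable [CompleteSpace H] {P : H →ₗ[ℂ] H}

theorem mem_orthProj_iff : P ∈ orthProj H ↔ P.IsSymmetricProjection := by
  constructor
  · rintro ⟨p, hp, rfl⟩
    exact ContinuousLinearMap.IsStarProjection.isSymmetricProjection hp
  · intro hP
    obtain ⟨_, h⟩ := LinearMap.isSymmetricProjection_iff_eq_coe_starProjection_range.1 hP
    exact ⟨_, isStarProjection_starProjection, h.symm⟩

theorem comp_self_of_mem_orthProj (hP : P ∈ orthProj H) : P ∘ₗ P = P :=
  (mem_orthProj_iff.1 hP).isIdempotentElem

theorem inner_apply_sub_apply (hP : P ∈ orthProj H) (x y : H) : inner ℂ (P x) (y - P y) = 0 := by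
  have hPP : P (P y) = P y := LinearMap.congr_fun (comp_self_of_mem_orthProj hP) y
  rw [(mem_orthProj_iff.1 hP).isSymmetric, map_sub, hPP, sub_self, inner_zero_right]

theorem norm_sq_eq_add_of_mem_orthProj (hP : P ∈ orthProj H) (x : H) :
    ‖x‖ ^ 2 = ‖P x‖ ^ 2 + ‖x - P x‖ ^ 2 := by
  have := norm_add_sq_eq_norm_sq_add_norm_sq_of_inner_eq_zero (P x) (x - P x)
    (inner_apply_sub_apply hP x x)
  rw [add_sub_cancel] at this
  rw [sq, this, sq, sq]

theorem exists_orthonormal_pair (hP : P ∈ orthProj H) (hP' : P ∉ trivialProj H) :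
    ∃ u v, P u = u ∧ P v = 0 ∧ Orthonormal ℂ ![u, v] := by
  have hPP (x) : P (P x) = P x := LinearMap.congr_fun (comp_self_of_mem_orthProj hP) x
  obtain ⟨a, ha⟩ : ∃ a, P a ≠ 0 := by
    by_contra! h
    exact hP' (Or.inl (LinearMap.ext h))
  obtain ⟨b, hb⟩ : ∃ b, b - P b ≠ 0 := by
    by_contra! h
    exact hP' (Or.inr (LinearMap.ext fun x => (sub_eq_zero.1 (h x)).symm))
  refine ⟨(‖P a‖⁻¹ : ℂ) • P a, (‖b - P b‖⁻¹ : ℂ) • (b - P b), ?_, ?_, ?_⟩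
  · rw [map_smul, hPP]
  · rw [map_smul, map_sub, hPP, sub_self, smul_zero]
  · simp [orthonormal_vecCons_iff, norm_smul, inner_smul_left, inner_smul_right,
      inner_apply_sub_apply hP, ha, hb]

theorem subset_trivialProj {S : Set (H →ₗ[ℂ] H)} (hS : S ⊆ orthProj H)
    (hne : ∀ P ∈ S, ∀ u v, P u = u → P v = 0 → ¬ Orthonormal ℂ ![u, v]) : S ⊆ trivialProj H := by
  intro P hP
  by_contra hP'
  obtain ⟨u, v, hu, hv, huv⟩ := exists_orthonormal_pair (hS hP) hP'
  exact hne P hP u v hu hv huv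

end Orthogonal

namespace IsTwofoldSum

variable {H : Type*} [NormedAddCommGroup H] [InnerProductSpace ℂ H]
variable {o : MatrixNorms H} {c : MatrixNorms (Fin 2 → H)}

theorem trivialProj_subset_completeSplitProj (h : IsTwofoldSum o c) :
    trivialProj H ⊆ completeSplitProj o c := by
  rintro P (rfl | rfl)
  exacts [h.zero_mem_completeSplitProj, h.id_mem_completeSplitProj]

theorem completeSplitProj_eq_trivialProj (h : IsTwofoldSum o c)
    (hS : splitProj o c = trivialProj H) : completeSplitProj o c = trivialProj H :=
  (h.completeSplitProj_subset_splitProj.trans hS.subset).antisymm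
    h.trivialProj_subset_completeSplitProj

variable [CompleteSpace H]

theorem splitProj_subset_orthProj (h : IsTwofoldSum o c) (h1 : ∀ ξ, o.one ξ = ‖ξ‖) :
    splitProj o c ⊆ orthProj H := by
  rintro P ⟨hP, hx⟩
  refine mem_orthProj_iff.2 (isSymmetricProjection_of_norm_apply_le hP fun x => ?_)
  rw [← h1, ← h1, hx x]
  exact h.nrm_apply_le (Matrix.of fun (_ _ : Unit) => splitMap P x) 0

theorem splitProj_eq_orthProj (h : IsTwofoldSum o c) (h1 : ∀ ξ, o.one ξ = ‖ξ‖)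
    (hc : ∀ P ∈ orthProj H, ∀ ξ, c.one (splitMap P ξ) = ‖ξ‖) : splitProj o c = orthProj H :=
  (h.splitProj_subset_orthProj h1).antisymm fun P hP =>
    ⟨comp_self_of_mem_orthProj hP, fun ξ => (h1 ξ).trans (hc P hP ξ).symm⟩

theorem completeSplitProj_eq_orthProj (h : IsTwofoldSum o c) (h1 : ∀ ξ, o.one ξ = ‖ξ‖)
    (hc : ∀ P ∈ orthProj H, IsCompleteIsometry o c (splitMap P)) :
    completeSplitProj o c = orthProj H :=
  (h.completeSplitProj_subset_splitProj.trans (h.splitProj_subset_orthProj h1)).antisymm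
    fun P hP => ⟨comp_self_of_mem_orthProj hP, hc P hP⟩

theorem splitProj_eq_trivialProj (h : IsTwofoldSum o c) (h1 : ∀ ξ, o.one ξ = ‖ξ‖)
    (hne : ∀ u v, Orthonormal ℂ ![u, v] → c.one ![u, v] ≠ √2) : splitProj o c = trivialProj H := by
  refine (subset_trivialProj (h.splitProj_subset_orthProj h1) ?_).antisymm
    (h.trivialProj_subset_completeSplitProj.trans h.completeSplitProj_subset_splitProj)
  rintro P ⟨-, hP⟩ u v hu hv huv
  apply hne u v huv
  rw [← splitMap_add_of_apply_eq hu hv, ← hP, h1, norm_add_of_orthonormal huv]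

theorem completeSplitProj_eq_trivialProj_of_forall (h : IsTwofoldSum o c)
    (h1 : ∀ ξ, o.one ξ = ‖ξ‖)
    (hne : ∀ P ∈ completeSplitProj o c, ∀ u v, P u = u → P v = 0 → ¬ Orthonormal ℂ ![u, v]) :
    completeSplitProj o c = trivialProj H :=
  (subset_trivialProj (h.completeSplitProj_subset_splitProj.trans
    (h.splitProj_subset_orthProj h1)) hne).antisymm h.trivialProj_subset_completeSplitProj

end IsTwofoldSum

/-! ### Row and column Hilbert spaces -/

section Row

variable {H : Type*} [NormedAddCommGroup H] [InnerProductSpace ℂ H]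
variable {m n : Type} [Fintype m] [Fintype n] {ι : Type} [Fintype ι] {b : ι → H}

theorem sum_norm_sq_apply_le_of_orthonormal (hb : Orthonormal ℂ b) (f : StrongDual ℂ H) :
    ∑ k, ‖f (b k)‖ ^ 2 ≤ ‖f‖ ^ 2 := by
  set S := ∑ k, ‖f (b k)‖ ^ 2 with hS
  let z := ∑ k, starRingEnd ℂ (f (b k)) • b k
  have norm_z : ‖z‖ ^ 2 = S := by
    simp only [z, norm_sq_sum_smul_of_orthonormal hb, RCLike.norm_conj, hS]
  have apply_z : f z = S := by
    simp [z, hS, Complex.conj_mul']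
  have h := f.le_opNorm z
  rw [apply_z, ← norm_z, Complex.norm_real, Real.norm_of_nonneg (sq_nonneg _)] at h
  rw [← norm_z]
  refine pow_le_pow_left₀ (norm_nonneg z) (not_lt.1 fun hlt => ?_) 2
  nlinarith [norm_nonneg f]

theorem rowHilbert_eq_scalarOpNorm (hb : Orthonormal ℂ b) {x : Matrix m n H} {a : m → n → ι → ℂ}
    (hx : ∀ i j, x i j = ∑ k, a i j k • b k) :
    (rowHilbert H).nrm x = scalarOpNorm (Matrix.of fun i (j : n × ι) => a i j.1 j.2) := by
  classical
  have apply_eq (w : n → StrongDual ℂ H) (i : m) :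
      ∑ j, NormedSpace.inclusionInDoubleDual ℂ H (x i j) (w j) =
        ∑ j : n × ι, a i j.1 j.2 * w j.1 (b j.2) := by
    simp [hx, Fintype.sum_prod_type]
  refine le_antisymm (concrete_le (scalarOpNorm_nonneg _) fun w => ?_)
    (scalarOpNorm_le (concrete_nonneg _ x) fun v => ?_)
  · simp only [apply_eq]
    refine (sum_norm_sq_mul_le (Matrix.of fun i (j : n × ι) => a i j.1 j.2) _).trans ?_
    refine mul_le_mul_of_nonneg_left ?_ (sq_nonneg _)
    rw [Fintype.sum_prod_type]
    exact Finset.sum_le_sum fun j _ => sum_norm_sq_apply_le_of_orthonormal hb (w j)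
  · let w (j : n) : StrongDual ℂ H := innerSL ℂ (∑ k, starRingEnd ℂ (v (j, k)) • b k)
    have norm_w : ∑ j, ‖w j‖ ^ 2 = ∑ j, ‖v j‖ ^ 2 := by
      simp only [Fintype.sum_prod_type, w, innerSL_apply_norm,
        norm_sq_sum_smul_of_orthonormal hb, RCLike.norm_conj]
    have w_apply (j : n × ι) : w j.1 (b j.2) = v j := by
      simp [w, orthonormal_iff_ite.1 hb]
    have h := sum_norm_sq_apply_le_concrete (NormedSpace.inclusionInDoubleDual ℂ H) x w
    simp only [apply_eq, w_apply, norm_w] at h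
    exact h

variable (H) in
theorem columnHilbert_op : (columnHilbert H).op = rowHilbert H := by
  refine congrArg MatrixNorms.mk ?_
  funext m n _ _ x
  obtain ⟨d, b, hb, hx⟩ := exists_orthonormal_span fun i : m × n => x i.1 i.2
  have row_eq := rowHilbert_eq_scalarOpNorm hb fun i j => hx (i, j)
  have col_eq := columnHilbert_eq_scalarOpNorm (x := x.transpose) hb fun j i => hx (i, j)
  exact (col_eq.trans (scalarOpNorm_transpose _).symm).trans row_eq.symm

variable (H) in
theorem rowHilbert_op : (rowHilbert H).op = columnHilbert H := by
  rw [← columnHilbert_op]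
  rfl

theorem rowHilbert_isWeakOperatorSpace : (rowHilbert H).IsWeakOperatorSpace :=
  columnHilbert_op H ▸ columnHilbert_isOperatorSpace.op.isWeakOperatorSpace

theorem rowHilbert_one (ξ : H) : (rowHilbert H).one ξ = ‖ξ‖ := by
  rw [← columnHilbert_op, ← columnHilbert_one]
  rfl

theorem rowHilbert_col_one_le {u v : H} (h : Orthonormal ℂ ![u, v]) :
    (rowHilbert H).col.one ![u, v] ≤ 1 := by
  rw [← columnHilbert_op]
  refine columnHilbert_le zero_le_one fun c => ?_
  simp [Fintype.sum_prod_type, norm_sq_smul_add_smul_of_orthonormal h]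

/- The pairing with `u` and `v` maps the pair `(u, v)` to `‖u‖ ^ 2 + ‖v‖ ^ 2 = 2`. -/
theorem two_le_mul_colProj_one {o : MatrixNorms H} (ho : o.IsWeakOperatorSpace) {u v : H}
    (h : Orthonormal ℂ ![u, v]) {C : ℝ} (hC : 0 < C)
    (hle : ∀ (s : Type) [Fintype s] (y : Matrix Unit s H),
      scalarOpNorm (Matrix.of fun i (l : Fin 2 × s) => inner ℂ (![u, v] l.1) (y i l.2)) ≤
        C * o.nrm y) :
    2 ≤ C * o.colProj.one ![u, v] := by
  have hu : ‖u‖ = 1 := h.1 0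
  have hv : ‖v‖ = 1 := h.1 1
  have trace_eq : scalarOpNorm (Matrix.of fun (_ _ : Unit) =>
      ∑ k, (innerSL ℂ (![u, v] k)).toLinearMap (![u, v] k)) = 2 := by
    refine (scalarOpNorm_of_const _).trans ?_
    norm_num [inner_self_eq_norm_sq_to_K, hu, hv]
  rw [← trace_eq]
  exact nrm_sum_le_colProj ho scalars_isWeakOperatorSpace.toIsBimodular
    (fun k => (innerSL ℂ (![u, v] k)).toLinearMap) hC hle (Matrix.of fun (_ _ : Unit) => ![u, v])

theorem two_le_colProj_one {o : MatrixNorms H} (ho : o.IsWeakOperatorSpace)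
    (hle : ∀ {m n : Type} [Fintype m] [Fintype n] (x : Matrix m n H),
      (rowHilbert H).nrm x ≤ o.nrm x) {u v : H} (h : Orthonormal ℂ ![u, v]) :
    2 ≤ o.colProj.one ![u, v] := by
  have row_le (s : Type) [Fintype s] (y : Matrix Unit s H) :
      scalarOpNorm (Matrix.of fun i (l : Fin 2 × s) => inner ℂ (![u, v] l.1) (y i l.2)) ≤
        (rowHilbert H).nrm y := by
    rw [← columnHilbert_op]
    refine (scalarOpNorm_transpose _).symm.trans_le ?_
    refine scalarOpNorm_le (columnHilbert_nonneg _) fun c => ?_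
    refine le_trans ?_ (sum_norm_sq_smul_le_columnHilbert y.transpose c)
    rw [Fintype.sum_prod_type, Finset.sum_comm]
    refine Finset.sum_le_sum fun j _ => ?_
    refine le_of_eq_of_le ?_ (h.sum_inner_products_le _ (s := Finset.univ))
    simp [Fin.sum_univ_two, inner_smul_right, mul_comm]
  rw [← one_mul (o.colProj.one _)]
  exact two_le_mul_colProj_one ho h one_pos fun s _ y =>
    ((row_le s y).trans (hle y)).trans_eq (one_mul _).symm

end Row

section Column

variable {H : Type*} [NormedAddCommGroup H] [InnerProductSpace ℂ H]
variable {m n : Type} [Fintype m] [Fintype n]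

theorem columnHilbert_isWeakOperatorSpace : (columnHilbert H).IsWeakOperatorSpace :=
  columnHilbert_isOperatorSpace.isWeakOperatorSpace

theorem columnHilbert_isTwofoldSum_col : IsTwofoldSum (columnHilbert H) (columnHilbert H).col :=
  columnHilbert_isWeakOperatorSpace.isTwofoldSum_col

theorem columnHilbert_isTwofoldSum_colProj :
    IsTwofoldSum (columnHilbert H) (columnHilbert H).colProj :=
  columnHilbert_isWeakOperatorSpace.isTwofoldSum_colProj

theorem colProj_le_columnHilbert_col {o : MatrixNorms H} (ho : o.IsBimodular)
    (hle : ∀ {m n : Type} [Fintype m] [Fintype n] (x : Matrix m n H),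
      o.nrm x ≤ (columnHilbert H).nrm x) (v : Matrix m n (Fin 2 → H)) :
    o.colProj.nrm v ≤ (columnHilbert H).col.nrm v := by
  classical
  obtain ⟨d, b, hb, hv⟩ := exists_orthonormal_span fun i : m × n × Fin 2 => v i.1 i.2.1 i.2.2
  let y : Matrix m (m × Fin d) H := Matrix.of fun i l => if i = l.1 then b l.2 else 0
  let A : Matrix ((m × Fin 2) × Fin d) n ℂ :=
    Matrix.of fun i j => inner ℂ (b i.2) (v i.1.1 j i.1.2)
  let e (l : Fin 2 × m × Fin d) : (m × Fin 2) × Fin d := ((l.2.1, l.1), l.2.2)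
  have factor : IsColFactorization v y (A.submatrix e id) := fun i j k => by
    simpa [y, A, e, Fintype.sum_prod_type (α₁ := m)] using hv (i, j, k)
  have y_le : (columnHilbert H).nrm y ≤ 1 := by
    refine columnHilbert_le zero_le_one fun c => le_of_eq ?_
    have (i : m) : ∑ l, c l • y i l = ∑ k, c (i, k) • b k := by
      simp [y, Fintype.sum_prod_type (α₁ := m)]
    simp only [this, norm_sq_sum_smul_of_orthonormal hb]
    rw [one_pow, one_mul, Fintype.sum_prod_type]
  have norm_A : scalarOpNorm A = (columnHilbert H).col.nrm v :=
    (columnHilbert_eq_scalarOpNorm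
      (x := Matrix.of fun (i : m × Fin 2) (j : n) => v i.1 j i.2) hb
      fun i j => hv (i.1, j, i.2)).symm
  have he : Function.Injective e := fun l l' h => by simp_all [e, Prod.ext_iff]
  calc o.colProj.nrm v ≤ o.nrm y * scalarOpNorm (A.submatrix e id) := colProj_le ho factor
    _ ≤ 1 * scalarOpNorm A := mul_le_mul ((hle y).trans y_le)
        (scalarOpNorm_submatrix_le A he Function.injective_id) (scalarOpNorm_nonneg _) zero_le_one
    _ = (columnHilbert H).col.nrm v := by rw [one_mul, norm_A]

variable [CompleteSpace H] {P : H →ₗ[ℂ] H}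

theorem columnHilbert_col_splitMap (hP : P ∈ orthProj H) (x : Matrix m n H) :
    (columnHilbert H).col.nrm (x.map (splitMap P)) = (columnHilbert H).nrm x := by
  have norm_sq_eq (v : n → ℂ) : ∑ i : m × Fin 2, ‖∑ j, v j • splitMap P (x i.1 j) i.2‖ ^ 2 =
      ∑ i, ‖∑ j, v j • x i j‖ ^ 2 := by
    rw [Fintype.sum_prod_type]
    refine Finset.sum_congr rfl fun i _ => ?_
    rw [norm_sq_eq_add_of_mem_orthProj hP]
    simp [splitMap, smul_sub]
  exact (columnHilbert_le_of_forall_sum_le fun v => (norm_sq_eq v).le).antisymm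
    (columnHilbert_le_of_forall_sum_le fun v => (norm_sq_eq v).ge)

theorem columnHilbert_le_colProj_splitMap (hP : P ∈ orthProj H) (x : Matrix m n H) :
    (columnHilbert H).nrm x ≤ (columnHilbert H).colProj.nrm (x.map (splitMap P)) := by
  have hPP (ξ : H) : P (P ξ) = P ξ := LinearMap.congr_fun (comp_self_of_mem_orthProj hP) ξ
  let T : Fin 2 → H →ₗ[ℂ] H := ![P, LinearMap.id - P]
  have norm_sq_le (a b : H) : ‖P a + (b - P b)‖ ^ 2 ≤ ‖a‖ ^ 2 + ‖b‖ ^ 2 := by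
    rw [norm_sq_eq_add_of_mem_orthProj hP (P a + (b - P b)),
      norm_sq_eq_add_of_mem_orthProj hP a, norm_sq_eq_add_of_mem_orthProj hP b]
    simp only [map_add, map_sub, hPP, sub_self, add_zero, add_sub_cancel_left]
    linarith [sq_nonneg ‖a - P a‖, sq_nonneg ‖P b‖]
  have T_le (s : Type) [Fintype s] (y : Matrix m s H) :
      (columnHilbert H).nrm (Matrix.of fun i (l : Fin 2 × s) => T l.1 (y i l.2)) ≤
        1 * (columnHilbert H).nrm y := by
    rw [one_mul]
    refine columnHilbert_le (columnHilbert_nonneg y) fun c => ?_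
    simp only [Fintype.sum_prod_type, Fin.sum_univ_two, mul_add]
    refine le_trans ?_ (add_le_add
      (sum_norm_sq_smul_le_columnHilbert y fun j => c (0, j))
      (sum_norm_sq_smul_le_columnHilbert y fun j => c (1, j)))
    rw [← Finset.sum_add_distrib]
    refine Finset.sum_le_sum fun i _ => le_of_eq_of_le ?_ (norm_sq_le _ _)
    simp [T, smul_sub]
  refine le_of_eq_of_le (congrArg (columnHilbert H).nrm ?_)
    ((nrm_sum_le_colProj columnHilbert_isWeakOperatorSpace
      columnHilbert_isWeakOperatorSpace.toIsBimodular T one_pos T_le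
      (x.map (splitMap P))).trans_eq (one_mul _))
  ext i j
  simp [T, splitMap, hPP]

variable (H)

theorem columnHilbert_completeLeftM : (columnHilbert H).completeLeftM = orthProj H :=
  columnHilbert_isWeakOperatorSpace.completeLeftM_eq.trans
    (columnHilbert_isTwofoldSum_col.completeSplitProj_eq_orthProj columnHilbert_one
      fun _ hP _ => columnHilbert_col_splitMap hP)

theorem columnHilbert_completeLeftL : (columnHilbert H).completeLeftL = orthProj H :=
  columnHilbert_isTwofoldSum_colProj.completeSplitProj_eq_orthProj columnHilbert_one
    fun _ hP _ x =>
      ((colProj_le_columnHilbert_col columnHilbert_isWeakOperatorSpace.toIsBimodular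
        (fun _ => le_rfl) _).trans_eq (columnHilbert_col_splitMap hP x)).antisymm
        (columnHilbert_le_colProj_splitMap hP x)

theorem columnHilbert_leftM : (columnHilbert H).leftM = orthProj H :=
  columnHilbert_isTwofoldSum_col.splitProj_eq_orthProj columnHilbert_one fun _ hP ξ =>
    (columnHilbert_col_splitMap hP (Matrix.of fun (_ _ : Unit) => ξ)).trans (columnHilbert_one ξ)

theorem columnHilbert_leftL : (columnHilbert H).leftL = orthProj H :=
  (columnHilbert_isTwofoldSum_colProj.splitProj_subset_orthProj columnHilbert_one).antisymm
    ((columnHilbert_completeLeftL H).superset.trans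
      columnHilbert_isTwofoldSum_colProj.completeSplitProj_subset_splitProj)

theorem rowHilbert_leftM : (rowHilbert H).leftM = trivialProj H :=
  rowHilbert_isWeakOperatorSpace.isTwofoldSum_col.splitProj_eq_trivialProj rowHilbert_one
    fun _ _ h => ((rowHilbert_col_one_le h).trans_lt Real.one_lt_sqrt_two).ne

theorem rowHilbert_leftL : (rowHilbert H).leftL = trivialProj H :=
  rowHilbert_isWeakOperatorSpace.isTwofoldSum_colProj.splitProj_eq_trivialProj rowHilbert_one
    fun _ _ h => ((Real.sqrt_two_lt_three_halves.trans (by norm_num)).trans_le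
      (two_le_colProj_one rowHilbert_isWeakOperatorSpace (fun _ => le_rfl) h)).ne'

theorem rowHilbert_completeLeftM : (rowHilbert H).completeLeftM = trivialProj H :=
  rowHilbert_isWeakOperatorSpace.completeLeftM_eq.trans
    (rowHilbert_isWeakOperatorSpace.isTwofoldSum_col.completeSplitProj_eq_trivialProj
      (rowHilbert_leftM H))

theorem rowHilbert_completeLeftL : (rowHilbert H).completeLeftL = trivialProj H :=
  rowHilbert_isWeakOperatorSpace.isTwofoldSum_colProj.completeSplitProj_eq_trivialProj
    (rowHilbert_leftL H)

end Column

/-! ### Pisier's operator Hilbert space -/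

section OperatorHilbert

open scoped Kronecker Matrix

variable {H : Type*} [NormedAddCommGroup H] [InnerProductSpace ℂ H]
variable {m n p q : Type} [Fintype m] [Fintype n] [Fintype p] [Fintype q]

theorem scalarOpNorm_kronecker_le (A : Matrix m n ℂ) (B : Matrix p q ℂ) :
    scalarOpNorm (A ⊗ₖ B) ≤ scalarOpNorm A * scalarOpNorm B := by
  refine scalarOpNorm_le (mul_nonneg (scalarOpNorm_nonneg A) (scalarOpNorm_nonneg B)) fun v => ?_
  have apply_eq (i : m) (i' : p) : ∑ j, (A ⊗ₖ B) (i, i') j * v j =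
      ∑ j, A i j * ∑ j', B i' j' * v (j, j') := by
    simp only [Fintype.sum_prod_type, Matrix.kronecker_apply, Finset.mul_sum, mul_assoc]
  calc ∑ i, ‖∑ j, (A ⊗ₖ B) i j * v j‖ ^ 2
    _ = ∑ i', ∑ i, ‖∑ j, A i j * ∑ j', B i' j' * v (j, j')‖ ^ 2 := by
        rw [Fintype.sum_prod_type_right]
        simp only [apply_eq]
    _ ≤ ∑ i', scalarOpNorm A ^ 2 * ∑ j, ‖∑ j', B i' j' * v (j, j')‖ ^ 2 :=
        Finset.sum_le_sum fun i' _ => sum_norm_sq_mul_le A _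
    _ = scalarOpNorm A ^ 2 * ∑ j, ∑ i', ‖∑ j', B i' j' * v (j, j')‖ ^ 2 := by
        rw [← Finset.mul_sum, Finset.sum_comm]
    _ ≤ scalarOpNorm A ^ 2 * ∑ j, scalarOpNorm B ^ 2 * ∑ j', ‖v (j, j')‖ ^ 2 := by
        gcongr with j
        exact sum_norm_sq_mul_le B _
    _ = (scalarOpNorm A * scalarOpNorm B) ^ 2 * ∑ j, ‖v j‖ ^ 2 := by
        rw [← Finset.mul_sum, Fintype.sum_prod_type, mul_pow, mul_assoc]

/-- The matrix of all the inner products of entries of a matrix of vectors, whose norm is the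
square of the norm in `H_o`. -/
def gram (x : Matrix m n H) : Matrix (m × m) (n × n) ℂ :=
  Matrix.of fun i j => inner ℂ (x i.1 j.1) (x i.2 j.2)

theorem gram_bimul {p q : Type} (α : Matrix p m ℂ) (x : Matrix m n H) (β : Matrix n q ℂ) :
    gram (Matrix.bimul α x β) = Matrix.bimul (α.map (starRingEnd ℂ) ⊗ₖ α) (gram x)
      (β.map (starRingEnd ℂ) ⊗ₖ β) := by
  ext ⟨i, i'⟩ ⟨j, j'⟩
  simp only [gram, Matrix.bimul, Matrix.of_apply, Fintype.sum_prod_type, sum_inner]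
  simp only [inner_sum, inner_smul_left, inner_smul_right]
  refine Finset.sum_congr rfl fun k _ => ?_
  rw [Finset.sum_comm]
  refine Finset.sum_congr rfl fun k' _ => Finset.sum_congr rfl fun l _ =>
    Finset.sum_congr rfl fun l' _ => ?_
  simp only [Matrix.kronecker_apply, Matrix.map_apply, smul_eq_mul, map_mul]
  ring

theorem operatorHilbert_isBimodular : (operatorHilbert H).IsBimodular where
  nonneg x := Real.sqrt_nonneg _
  bimul_le {p m n q} _ _ _ _ α x β := by
    have kronecker_le {r s : Type} [Fintype r] [Fintype s] (A : Matrix r s ℂ) :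
        scalarOpNorm (A.map (starRingEnd ℂ) ⊗ₖ A) ≤ scalarOpNorm A ^ 2 := by
      rw [sq]
      exact (scalarOpNorm_kronecker_le _ A).trans_eq (by rw [scalarOpNorm_map_conj])
    have hα := scalarOpNorm_nonneg α
    have hβ := scalarOpNorm_nonneg β
    have hx := scalarOpNorm_nonneg (gram x)
    have := scalarOpNorm_nonneg (β.map (starRingEnd ℂ) ⊗ₖ β)
    have := Real.sqrt_nonneg (scalarOpNorm (gram x))
    refine Real.sqrt_le_iff.2 ⟨mul_nonneg (mul_nonneg hα this) hβ, ?_⟩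
    calc scalarOpNorm (gram (Matrix.bimul α x β))
      _ ≤ scalarOpNorm (α.map (starRingEnd ℂ) ⊗ₖ α) * scalarOpNorm (gram x) *
          scalarOpNorm (β.map (starRingEnd ℂ) ⊗ₖ β) := by
          rw [gram_bimul]
          exact scalars_isWeakOperatorSpace.bimul_le _ _ _
      _ ≤ scalarOpNorm α ^ 2 * scalarOpNorm (gram x) * scalarOpNorm β ^ 2 := by
          gcongr <;> exact kronecker_le _
      _ = _ := by rw [mul_pow, mul_pow, ← Real.sq_sqrt hx]; rfl

theorem operatorHilbert_isWeakOperatorSpace : (operatorHilbert H).IsWeakOperatorSpace where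
  toIsBimodular := operatorHilbert_isBimodular
  nrm_blockDiagonal_le {ι m n} _ _ _ _ x := by
    let e (l : Type) : (l × ι) × l × ι ≃ (l × l) × ι × ι := Equiv.prodProdProdComm l ι l ι
    have gram_blockDiagonal : gram (Matrix.blockDiagonal fun _ : ι => x) =
        (Matrix.blockDiagonal fun _ : ι × ι => gram x).submatrix (e m) (e n) := by
      ext ⟨⟨a, b⟩, c, d⟩ ⟨⟨a', b'⟩, c', d'⟩
      by_cases h1 : b = b' <;> by_cases h2 : d = d' <;>
        simp [gram, e, Matrix.blockDiagonal_apply, h1, h2]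
    refine Real.sqrt_le_sqrt ?_
    calc scalarOpNorm (gram (Matrix.blockDiagonal fun _ : ι => x))
      _ ≤ scalarOpNorm (Matrix.blockDiagonal fun _ : ι × ι => gram x) := by
          rw [gram_blockDiagonal]
          exact scalarOpNorm_submatrix_le _ (e m).injective (e n).injective
      _ ≤ scalarOpNorm (gram x) := scalars_isWeakOperatorSpace.nrm_blockDiagonal_le _

theorem operatorHilbert_one (ξ : H) : (operatorHilbert H).one ξ = ‖ξ‖ := by
  have : Unique (Unit × Unit) := (Equiv.punitProd Unit).unique
  refine (congrArg Real.sqrt (scalarOpNorm_of_const (inner ℂ ξ ξ))).trans ?_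
  rw [inner_self_eq_norm_sq_to_K]
  simp

variable (H) in
theorem operatorHilbert_op : (operatorHilbert H).op = operatorHilbert H := by
  refine congrArg MatrixNorms.mk ?_
  funext m n _ _ x
  exact congrArg Real.sqrt (scalarOpNorm_transpose (gram x))

theorem operatorHilbert_col_one_lt {u v : H} (h : Orthonormal ℂ ![u, v]) :
    (operatorHilbert H).col.one ![u, v] < √2 := by
  have hu : ‖u‖ = 1 := h.1 0
  have hv : ‖v‖ = 1 := h.1 1
  have huv : inner ℂ u v = 0 := h.2 (show (0 : Fin 2) ≠ 1 by decide)
  have hvu : inner ℂ v u = 0 := h.2 (show (1 : Fin 2) ≠ 0 by decide)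
  refine Real.sqrt_lt_sqrt (scalarOpNorm_nonneg _) ?_
  refine lt_of_le_of_lt (scalarOpNorm_le (Real.sqrt_nonneg 2) fun c => le_of_eq ?_)
    (Real.sqrt_two_lt_three_halves.trans (by norm_num))
  simp [Fintype.sum_prod_type, hu, hv, huv, hvu]
  ring

variable {ι : Type} [Fintype ι] {b : ι → H}

theorem sum_norm_sq_conjTranspose_mul_self (A : Matrix m n ℂ) :
    ∑ i, ∑ j, ‖(Aᴴ * A) i j‖ ^ 2 = ∑ i, ∑ j, ‖(A * Aᴴ) i j‖ ^ 2 := by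
  have trace_eq {k : Type} [Fintype k] (B : Matrix k k ℂ) :
      ((∑ i, ∑ j, ‖B i j‖ ^ 2 : ℝ) : ℂ) = (B * Bᴴ).trace := by
    simp [Matrix.trace, Matrix.mul_apply, Complex.mul_conj']
  rw [← Complex.ofReal_inj, trace_eq, trace_eq]
  simp only [Matrix.conjTranspose_mul, Matrix.conjTranspose_conjTranspose, Matrix.mul_assoc]
  rw [Matrix.trace_mul_comm]
  simp only [Matrix.mul_assoc]

theorem sum_norm_sq_sum_conj_smul (W : Matrix ι n ℂ) (η : n → H) :
    ((∑ k, ‖∑ j, starRingEnd ℂ (W k j) • η j‖ ^ 2 : ℝ) : ℂ) =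
      ∑ j, ∑ j', (Wᴴ * W) j' j * inner ℂ (η j) (η j') := by
  have norm_sq_eq (k : ι) : ((‖∑ j, starRingEnd ℂ (W k j) • η j‖ ^ 2 : ℝ) : ℂ) =
      ∑ j, ∑ j', W k j * starRingEnd ℂ (W k j') * inner ℂ (η j) (η j') := by
    rw [Complex.ofReal_pow, ← Complex.coe_algebraMap, ← inner_self_eq_norm_sq_to_K]
    simp only [sum_inner]
    simp only [inner_sum, inner_smul_left, inner_smul_right, Complex.conj_conj]
    exact Finset.sum_congr rfl fun j _ => Finset.sum_congr rfl fun j' _ => by ring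
  rw [Complex.ofReal_sum]
  simp only [norm_sq_eq]
  rw [Finset.sum_comm]
  refine Finset.sum_congr rfl fun j _ => ?_
  rw [Finset.sum_comm]
  simp [Matrix.mul_apply, Finset.mul_sum, mul_comm]

/- Compressing the vectors to the span of `b` decreases the Hilbert-Schmidt norm of their Gram
matrix: with the Gram matrices `G` of `η` and `WᴴW` of the compressed vectors,
`‖WᴴW‖² ≤ ⟪WᴴW, G⟫ ≤ (‖WᴴW‖² + ‖G‖²) / 2` in Hilbert-Schmidt norm. -/
theorem sum_sum_norm_sq_inner_sq_le (hb : Orthonormal ℂ b) (η : n → H) :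
    ∑ k, (∑ j, ‖inner ℂ (b k) (η j)‖ ^ 2) ^ 2 ≤ ∑ j, ∑ j', ‖inner ℂ (η j) (η j')‖ ^ 2 := by
  let W : Matrix ι n ℂ := Matrix.of fun k j => inner ℂ (b k) (η j)
  let ζ (k : ι) : H := ∑ j, starRingEnd ℂ (W k j) • η j
  have diag_le : ∑ k, (∑ j, ‖W k j‖ ^ 2) ^ 2 ≤ ∑ k, ∑ l, ‖(W * Wᴴ) k l‖ ^ 2 := by
    refine Finset.sum_le_sum fun k _ => ?_
    have diag : (W * Wᴴ) k k = ((∑ j, ‖W k j‖ ^ 2 : ℝ) : ℂ) := by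
      simp [Matrix.mul_apply, Complex.mul_conj']
    refine le_of_eq_of_le ?_ (Finset.single_le_sum (f := fun l => ‖(W * Wᴴ) k l‖ ^ 2)
      (fun l _ => sq_nonneg _) (Finset.mem_univ k))
    rw [diag, Complex.norm_real, Real.norm_of_nonneg (by positivity)]
  have bessel : ∑ k, ∑ l, ‖(W * Wᴴ) k l‖ ^ 2 ≤ ∑ k, ‖ζ k‖ ^ 2 := by
    rw [Finset.sum_comm]
    refine Finset.sum_le_sum fun k _ => ?_
    refine le_of_eq_of_le ?_ (hb.sum_inner_products_le (ζ k) (s := Finset.univ))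
    simp [ζ, W, Matrix.mul_apply, inner_sum, inner_smul_right, mul_comm]
  have pairing_le : ∑ k, ‖ζ k‖ ^ 2 ≤
      (∑ k, ∑ l, ‖(W * Wᴴ) k l‖ ^ 2 + ∑ j, ∑ j', ‖inner ℂ (η j) (η j')‖ ^ 2) / 2 := by
    rw [← Real.norm_of_nonneg (by positivity : 0 ≤ ∑ k, ‖ζ k‖ ^ 2), ← Complex.norm_real,
      sum_norm_sq_sum_conj_smul, ← sum_norm_sq_conjTranspose_mul_self,
      Finset.sum_comm (f := fun j j' => ‖(Wᴴ * W) j j'‖ ^ 2),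
      ← Finset.sum_add_distrib, Finset.sum_div]
    refine norm_sum_le_of_le _ fun j _ => ?_
    rw [← Finset.sum_add_distrib, Finset.sum_div]
    refine norm_sum_le_of_le _ fun j' _ => ?_
    rw [norm_mul]
    linarith [two_mul_le_add_sq ‖(Wᴴ * W) j' j‖ ‖inner ℂ (η j) (η j')‖]
  exact diag_le.trans (by linarith)

theorem sum_norm_sq_inner_le_gram (x : Matrix m n H) (c : m → ℂ) :
    ∑ j, ∑ j', ‖inner ℂ (∑ i, c i • x i j) (∑ i, c i • x i j')‖ ^ 2 ≤
      (scalarOpNorm (gram x) * ∑ i, ‖c i‖ ^ 2) ^ 2 := by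
  have h := sum_norm_sq_mul_le (gram x).transpose fun i => starRingEnd ℂ (c i.1) * c i.2
  simp only [scalarOpNorm_transpose, norm_mul, RCLike.norm_conj, mul_pow, Fintype.sum_prod_type,
    ← Finset.mul_sum, ← Finset.sum_mul, ← sq] at h
  rw [mul_pow]
  refine le_of_eq_of_le (Finset.sum_congr rfl fun j _ => Finset.sum_congr rfl fun j' _ => ?_) h
  simp only [sum_inner]
  simp only [inner_sum, inner_smul_left, inner_smul_right, gram, Matrix.transpose_apply,
    Matrix.of_apply]
  congr 2
  exact Finset.sum_congr rfl fun i _ => Finset.sum_congr rfl fun i' _ => by ring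

theorem operatorHilbert_row_le (hb : Orthonormal ℂ b) (x : Matrix m n H) :
    scalarOpNorm (Matrix.of fun i (l : ι × n) => inner ℂ (b l.1) (x i l.2)) ≤
      √√(Fintype.card ι) * (operatorHilbert H).nrm x := by
  rw [← scalarOpNorm_transpose]
  refine scalarOpNorm_le (mul_nonneg (Real.sqrt_nonneg _) (Real.sqrt_nonneg _)) fun c => ?_
  let η (j : n) : H := ∑ i, c i • x i j
  let t (k : ι) : ℝ := ∑ j, ‖inner ℂ (b k) (η j)‖ ^ 2
  have hx := scalarOpNorm_nonneg (gram x)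
  calc _ = ∑ k, t k := by
        simp [t, η, Fintype.sum_prod_type, mul_comm]
    _ ≤ √(Fintype.card ι * ∑ k, t k ^ 2) := Real.le_sqrt_of_sq_le sq_sum_le_card_mul_sum_sq
    _ ≤ √(Fintype.card ι * (scalarOpNorm (gram x) * ∑ i, ‖c i‖ ^ 2) ^ 2) := by
        gcongr
        exact (sum_sum_norm_sq_inner_sq_le hb η).trans (sum_norm_sq_inner_le_gram x c)
    _ = √(Fintype.card ι) * (scalarOpNorm (gram x) * ∑ i, ‖c i‖ ^ 2) := by
        rw [Real.sqrt_mul (Nat.cast_nonneg _), Real.sqrt_sq (by positivity)]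
    _ = (√√(Fintype.card ι) * √(scalarOpNorm (gram x))) ^ 2 * ∑ i, ‖c i‖ ^ 2 := by
        rw [mul_pow, Real.sq_sqrt (Real.sqrt_nonneg _), Real.sq_sqrt hx, mul_assoc]

theorem sqrt_two_lt_operatorHilbert_colProj_one {u v : H} (h : Orthonormal ℂ ![u, v]) :
    √2 < (operatorHilbert H).colProj.one ![u, v] := by
  have two_le : 2 ≤ √√2 * (operatorHilbert H).colProj.one ![u, v] :=
    two_le_mul_colProj_one operatorHilbert_isWeakOperatorSpace h (by positivity)
      fun s _ y => (operatorHilbert_row_le h y).trans_eq (by simp)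
  have sqrt_lt : √√2 < √2 := Real.sqrt_lt_sqrt (Real.sqrt_nonneg 2)
    (Real.sqrt_two_lt_three_halves.trans (by norm_num))
  have sqrt_pos : 0 < √√2 := by positivity
  nlinarith [Real.mul_self_sqrt (zero_le_two (α := ℝ))]

variable [CompleteSpace H]

variable (H)

theorem operatorHilbert_leftM : (operatorHilbert H).leftM = trivialProj H :=
  operatorHilbert_isBimodular.isTwofoldSum_col.splitProj_eq_trivialProj operatorHilbert_one
    fun _ _ h => (operatorHilbert_col_one_lt h).ne

theorem operatorHilbert_leftL : (operatorHilbert H).leftL = trivialProj H :=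
  operatorHilbert_isWeakOperatorSpace.isTwofoldSum_colProj.splitProj_eq_trivialProj
    operatorHilbert_one fun _ _ h => (sqrt_two_lt_operatorHilbert_colProj_one h).ne'

theorem operatorHilbert_completeLeftM : (operatorHilbert H).completeLeftM = trivialProj H :=
  operatorHilbert_isBimodular.completeLeftM_eq.trans
    (operatorHilbert_isBimodular.isTwofoldSum_col.completeSplitProj_eq_trivialProj
      (operatorHilbert_leftM H))

theorem operatorHilbert_completeLeftL : (operatorHilbert H).completeLeftL = trivialProj H :=
  operatorHilbert_isWeakOperatorSpace.isTwofoldSum_colProj.completeSplitProj_eq_trivialProj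
    (operatorHilbert_leftL H)

end OperatorHilbert

/-! ### The minimal operator space structure -/

section Min

variable {H : Type*} [NormedAddCommGroup H] [InnerProductSpace ℂ H]
variable {m n : Type} [Fintype m] [Fintype n]

theorem scalarOpNorm_map_le_columnHilbert {f : StrongDual ℂ H} (hf : ‖f‖ ≤ 1)
    (x : Matrix m n H) : scalarOpNorm (x.map f) ≤ (columnHilbert H).nrm x := by
  refine scalarOpNorm_le (columnHilbert_nonneg x) fun c =>
    (Finset.sum_le_sum fun i _ => ?_).trans (sum_norm_sq_smul_le_columnHilbert x c)
  have apply_sum : ∑ j, x.map f i j * c j = f (∑ j, c j • x i j) := by simp [mul_comm]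
  rw [apply_sum]
  gcongr
  exact (f.le_of_opNorm_le hf _).trans_eq (one_mul _)

theorem scalarOpNorm_map_le_minHilbert {f : StrongDual ℂ H} (hf : ‖f‖ ≤ 1) (x : Matrix m n H) :
    scalarOpNorm (x.map f) ≤ (minHilbert H).nrm x := by
  refine le_csSup ⟨(columnHilbert H).nrm x, ?_⟩ ⟨f, hf, rfl⟩
  rintro _ ⟨f, hf, rfl⟩
  exact scalarOpNorm_map_le_columnHilbert hf x

theorem minHilbert_le {x : Matrix m n H} {C : ℝ}
    (h : ∀ f : StrongDual ℂ H, ‖f‖ ≤ 1 → scalarOpNorm (x.map f) ≤ C) :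
    (minHilbert H).nrm x ≤ C := by
  refine csSup_le ⟨_, 0, by simp, rfl⟩ ?_
  rintro _ ⟨f, hf, rfl⟩
  exact h f hf

theorem minHilbert_le_columnHilbert (x : Matrix m n H) :
    (minHilbert H).nrm x ≤ (columnHilbert H).nrm x :=
  minHilbert_le fun _ hf => scalarOpNorm_map_le_columnHilbert hf x

theorem minHilbert_isWeakOperatorSpace : (minHilbert H).IsWeakOperatorSpace where
  nonneg x := (scalarOpNorm_nonneg _).trans (scalarOpNorm_map_le_minHilbert (f := 0) (by simp) x)
  bimul_le α x β := by
    have hα := scalarOpNorm_nonneg α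
    have hβ := scalarOpNorm_nonneg β
    refine minHilbert_le fun f hf => ?_
    have map_bimul : (Matrix.bimul α x β).map f = Matrix.bimul α (x.map f) β := by
      ext i j
      simp [Matrix.bimul]
    rw [map_bimul]
    refine (scalars_isWeakOperatorSpace.bimul_le α (x.map f) β).trans ?_
    gcongr
    exact scalarOpNorm_map_le_minHilbert hf x
  nrm_blockDiagonal_le x := by
    refine minHilbert_le fun f hf => ?_
    rw [Matrix.blockDiagonal_map _ _ (map_zero f)]
    exact (scalars_isWeakOperatorSpace.nrm_blockDiagonal_le (x.map f)).trans
      (scalarOpNorm_map_le_minHilbert hf x)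

variable (H) in
theorem minHilbert_op : (minHilbert H).op = minHilbert H := by
  refine congrArg MatrixNorms.mk ?_
  funext m n _ _ x
  exact congrArg sSup (Set.ext fun t => exists_congr fun f => and_congr_right fun _ =>
    Eq.congr_right (scalarOpNorm_transpose (x.map f)))

theorem norm_sq_sum_smul_le_minHilbert (y : Matrix m n H) (i : m) (c : n → ℂ) :
    ‖∑ j, c j • y i j‖ ^ 2 ≤ (minHilbert H).nrm y ^ 2 * ∑ j, ‖c j‖ ^ 2 := by
  obtain ⟨f, hf, hfz⟩ := exists_dual_vector'' ℂ (∑ j, c j • y i j)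
  have norm_eq : ‖∑ j, c j • y i j‖ = ‖∑ j, y.map f i j * c j‖ := by
    rw [← norm_norm (∑ j, c j • y i j), ← Complex.norm_real]
    exact congrArg norm (hfz.symm.trans (by simp [mul_comm]))
  calc ‖∑ j, c j • y i j‖ ^ 2 = ‖∑ j, y.map f i j * c j‖ ^ 2 := by rw [norm_eq]
    _ ≤ ∑ i, ‖∑ j, y.map f i j * c j‖ ^ 2 :=
        Finset.single_le_sum (f := fun i => ‖∑ j, y.map f i j * c j‖ ^ 2)
          (fun _ _ => sq_nonneg _) (Finset.mem_univ i)
    _ ≤ scalarOpNorm (y.map f) ^ 2 * ∑ j, ‖c j‖ ^ 2 := sum_norm_sq_mul_le _ _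
    _ ≤ (minHilbert H).nrm y ^ 2 * ∑ j, ‖c j‖ ^ 2 := by
        have := scalarOpNorm_nonneg (y.map f)
        gcongr
        exact scalarOpNorm_map_le_minHilbert hf y

theorem minHilbert_one (ξ : H) : (minHilbert H).one ξ = ‖ξ‖ := by
  refine ((minHilbert_le_columnHilbert _).trans_eq (columnHilbert_one ξ)).antisymm ?_
  have h := norm_sq_sum_smul_le_minHilbert (Matrix.of fun (_ _ : Unit) => ξ) () fun _ => 1
  simp only [Finset.univ_unique, Finset.sum_singleton, one_smul, norm_one, one_pow, mul_one] at h
  exact (pow_le_pow_iff_left₀ (norm_nonneg ξ) (minHilbert_isWeakOperatorSpace.nonneg _)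
    two_ne_zero).1 h

/- In a factorization `w = (β₁ y, β₂ y)` the coefficients of the two coordinates are disjoint parts
of the same column of `β`, so the two lower bounds add up. -/
theorem sqrt_sum_norm_sq_le_minHilbert_colProj (w : Matrix m n (Fin 2 → H)) (i : Fin 2 → m)
    (j : n) : √(∑ k, ‖w (i k) j k‖ ^ 2) ≤ (minHilbert H).colProj.nrm w := by
  classical
  refine le_colProj minHilbert_isWeakOperatorSpace fun s _ y β hw => ?_
  have hy := minHilbert_isWeakOperatorSpace.nonneg y
  have column_le : ∑ l, ‖β l j‖ ^ 2 ≤ scalarOpNorm β ^ 2 := by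
    simpa [Pi.single_apply, apply_ite, ite_pow] using sum_norm_sq_mul_le β (Pi.single j 1)
  refine Real.sqrt_le_iff.2 ⟨mul_nonneg hy (scalarOpNorm_nonneg β), ?_⟩
  calc ∑ k, ‖w (i k) j k‖ ^ 2
    _ ≤ ∑ k, (minHilbert H).nrm y ^ 2 * ∑ l, ‖β (k, l) j‖ ^ 2 :=
        Finset.sum_le_sum fun k _ => by
          rw [hw]
          exact norm_sq_sum_smul_le_minHilbert y (i k) fun l => β (k, l) j
    _ = (minHilbert H).nrm y ^ 2 * ∑ l, ‖β l j‖ ^ 2 := by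
        rw [← Finset.mul_sum, Fintype.sum_prod_type]
    _ ≤ ((minHilbert H).nrm y * scalarOpNorm β) ^ 2 := by
        rw [mul_pow]
        gcongr

theorem minHilbert_le_one_of_orthonormal {u v : H} (h : Orthonormal ℂ ![u, v])
    (x : Matrix m n H) (hx : ∀ f : StrongDual ℂ H, ∀ c : n → ℂ,
      ∑ i, ‖∑ j, f (x i j) * c j‖ ^ 2 ≤ (‖f u‖ ^ 2 + ‖f v‖ ^ 2) * ∑ j, ‖c j‖ ^ 2) :
    (minHilbert H).nrm x ≤ 1 := by
  refine minHilbert_le fun f hf => scalarOpNorm_le zero_le_one fun c => (hx f c).trans ?_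
  have bessel := (sum_norm_sq_apply_le_of_orthonormal h f).trans
    (pow_le_pow_left₀ (norm_nonneg f) hf 2)
  rw [Fin.sum_univ_two] at bessel
  gcongr
  exact bessel

variable [CompleteSpace H]

variable (H)

theorem minHilbert_leftM : (minHilbert H).leftM = trivialProj H := by
  refine minHilbert_isWeakOperatorSpace.isTwofoldSum_col.splitProj_eq_trivialProj minHilbert_one
    fun u v h => ?_
  have col_le : (minHilbert H).col.one ![u, v] ≤ 1 := by
    refine minHilbert_le_one_of_orthonormal h
      (Matrix.of fun (i : Unit × Fin 2) (_ : Unit) => ![u, v] i.2) fun f c => le_of_eq ?_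
    simp [Fintype.sum_prod_type, mul_pow, add_mul]
  exact (col_le.trans_lt Real.one_lt_sqrt_two).ne

theorem minHilbert_leftL : (minHilbert H).leftL = orthProj H := by
  refine minHilbert_isWeakOperatorSpace.isTwofoldSum_colProj.splitProj_eq_orthProj minHilbert_one
    fun P hP ξ => le_antisymm ?_ ?_
  · let x : Matrix Unit Unit H := Matrix.of fun _ _ => ξ
    exact ((colProj_le_columnHilbert_col minHilbert_isWeakOperatorSpace.toIsBimodular
      minHilbert_le_columnHilbert (x.map (splitMap P))).trans_eq
      (columnHilbert_col_splitMap hP x)).trans_eq (columnHilbert_one ξ)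
  · have h := sqrt_sum_norm_sq_le_minHilbert_colProj
      (Matrix.of fun (_ _ : Unit) => splitMap P ξ) (fun _ => ()) ()
    rw [Fin.sum_univ_two] at h
    refine le_of_eq_of_le ?_ h
    refine (Real.sqrt_sq (norm_nonneg ξ)).symm.trans (congrArg Real.sqrt ?_)
    exact norm_sq_eq_add_of_mem_orthProj hP ξ

theorem minHilbert_completeLeftL : (minHilbert H).completeLeftL = trivialProj H := by
  refine minHilbert_isWeakOperatorSpace.isTwofoldSum_colProj
    |>.completeSplitProj_eq_trivialProj_of_forall minHilbert_one ?_
  rintro P ⟨-, hP⟩ u v hu hv h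
  let x : Matrix (Fin 2) (Fin 2) H := !![u, 0; v, 0]
  have x_le : (minHilbert H).nrm x ≤ 1 := by
    refine minHilbert_le_one_of_orthonormal h x fun f c => ?_
    simp only [Fin.sum_univ_two, x, Matrix.of_apply, Matrix.cons_val', Matrix.cons_val_zero,
      Matrix.cons_val_one, map_zero, zero_mul, add_zero, norm_mul, mul_pow]
    nlinarith [sq_nonneg ‖c 1‖, sq_nonneg ‖f u‖, sq_nonneg ‖f v‖]
  have le_x := (sqrt_sum_norm_sq_le_minHilbert_colProj (x.map (splitMap P)) id 0).trans_eq (hP 2 x)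
  have hu1 : ‖u‖ = 1 := h.1 0
  have hv1 : ‖v‖ = 1 := h.1 1
  have sqrt_two_eq : √(∑ k, ‖x.map (splitMap P) (id k) 0 k‖ ^ 2) = √2 := by
    norm_num [Fin.sum_univ_two, x, splitMap, hu, hv, hu1, hv1]
  exact ((sqrt_two_eq.symm.le.trans le_x).trans x_le).not_gt Real.one_lt_sqrt_two

end Min

/-! ### The maximal operator space structure -/

section Max

variable {H : Type*} [NormedAddCommGroup H] [InnerProductSpace ℂ H] {o : MatrixNorms H}
variable {m n : Type} [Fintype m] [Fintype n]

theorem IsOperatorSpace.nrm_le_sum (ho : o.IsOperatorSpace) (x : Matrix m n H) :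
    o.nrm x ≤ ∑ i, ∑ j, o.one (x i j) := by
  classical
  have nrm_sum_le {ι : Type} [Fintype ι] (y : ι → Matrix m n H) :
      o.nrm (∑ i, y i) ≤ ∑ i, o.nrm (y i) :=
    Finset.le_sum_of_subadditive o.nrm ho.nrm_zero.le ho.add_le _ _
  have nrm_single_le (i : m) (j : n) (ξ : H) : o.nrm (Matrix.single i j ξ) ≤ o.one ξ := by
    have h := ho.bimul_le ((1 : Matrix m m ℂ).submatrix id fun _ : Unit => i)
      (Matrix.of fun _ _ => ξ) ((1 : Matrix n n ℂ).submatrix (fun _ : Unit => j) id)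
    have single_eq : Matrix.bimul ((1 : Matrix m m ℂ).submatrix id fun _ : Unit => i)
        (Matrix.of fun _ _ => ξ) ((1 : Matrix n n ℂ).submatrix (fun _ : Unit => j) id) =
        Matrix.single i j ξ := by
      ext k l
      by_cases hi : i = k <;> by_cases hj : j = l <;>
        simp [Matrix.bimul, Matrix.one_apply, hi, hj, Ne.symm]
    rw [single_eq] at h
    refine h.trans ?_
    have hξ := ho.isBimodular.nonneg (Matrix.of fun (_ _ : Unit) => ξ)
    calc _ ≤ 1 * o.one ξ * 1 := by
          refine mul_le_mul (mul_le_mul_of_nonneg_right ?_ hξ) ?_ (scalarOpNorm_nonneg _)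
            (mul_nonneg zero_le_one hξ)
          · exact scalarOpNorm_one_submatrix_right_le (Function.injective_of_subsingleton _)
          · exact scalarOpNorm_one_submatrix_left_le (Function.injective_of_subsingleton _)
      _ = o.one ξ := by rw [one_mul, mul_one]
  conv_lhs => rw [Matrix.matrix_eq_sum_single x]
  exact (nrm_sum_le _).trans (Finset.sum_le_sum fun i _ => (nrm_sum_le _).trans
    (Finset.sum_le_sum fun j _ => nrm_single_le i j _))

theorem IsOperatorSpace.nrm_le_maxHilbert (ho : o.IsOperatorSpace) (h1 : ∀ ξ, o.one ξ = ‖ξ‖)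
    (x : Matrix m n H) : o.nrm x ≤ (maxHilbert H).nrm x := by
  refine le_csSup ⟨∑ i, ∑ j, ‖x i j‖, ?_⟩ ⟨o, ho, h1, rfl⟩
  rintro _ ⟨o, ho, h1, rfl⟩
  simpa only [h1] using ho.nrm_le_sum x

theorem maxHilbert_le {x : Matrix m n H} {C : ℝ}
    (h : ∀ o : MatrixNorms H, o.IsOperatorSpace → (∀ ξ, o.one ξ = ‖ξ‖) → o.nrm x ≤ C) :
    (maxHilbert H).nrm x ≤ C := by
  refine csSup_le ⟨_, columnHilbert H, columnHilbert_isOperatorSpace, columnHilbert_one, rfl⟩ ?_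
  rintro _ ⟨o, ho, h1, rfl⟩
  exact h o ho h1

theorem columnHilbert_le_maxHilbert (x : Matrix m n H) :
    (columnHilbert H).nrm x ≤ (maxHilbert H).nrm x :=
  columnHilbert_isOperatorSpace.nrm_le_maxHilbert columnHilbert_one x

theorem rowHilbert_le_maxHilbert (x : Matrix m n H) :
    (rowHilbert H).nrm x ≤ (maxHilbert H).nrm x := by
  rw [← columnHilbert_op]
  exact columnHilbert_isOperatorSpace.op.nrm_le_maxHilbert columnHilbert_one x

theorem maxHilbert_isWeakOperatorSpace : (maxHilbert H).IsWeakOperatorSpace where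
  nonneg x := (columnHilbert_nonneg x).trans (columnHilbert_le_maxHilbert x)
  bimul_le α x β := by
    have hα := scalarOpNorm_nonneg α
    have hβ := scalarOpNorm_nonneg β
    refine maxHilbert_le fun o ho h1 => (ho.bimul_le α x β).trans ?_
    gcongr
    exact ho.nrm_le_maxHilbert h1 x
  nrm_blockDiagonal_le x := maxHilbert_le fun _ ho h1 =>
    (ho.isWeakOperatorSpace.nrm_blockDiagonal_le x).trans (ho.nrm_le_maxHilbert h1 x)

theorem maxHilbert_one (ξ : H) : (maxHilbert H).one ξ = ‖ξ‖ :=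
  (maxHilbert_le fun _ _ h1 => (h1 ξ).le).antisymm
    ((columnHilbert_one ξ).symm.trans_le (columnHilbert_le_maxHilbert _))

variable (H) in
theorem maxHilbert_op : (maxHilbert H).op = maxHilbert H := by
  refine congrArg MatrixNorms.mk ?_
  funext m n _ _ x
  have transpose_le {p q : Type} [Fintype p] [Fintype q] (y : Matrix p q H) :
      (maxHilbert H).nrm y.transpose ≤ (maxHilbert H).nrm y :=
    maxHilbert_le fun _ ho h1 => ho.op.nrm_le_maxHilbert h1 y
  exact (transpose_le x).antisymm (transpose_le x.transpose)

/-- The diagonal matrix with the given vectors on the diagonal. -/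
def diagonalPair (w : Fin 2 → H) : Matrix (Unit × Fin 2) (Unit × Fin 2) H :=
  Matrix.blockDiagonal fun k => Matrix.of fun (_ _ : Unit) => w k

theorem IsOperatorSpace.nrm_bimul_diagonalPair_le (ho : o.IsOperatorSpace)
    (h1 : ∀ ξ, o.one ξ = ‖ξ‖) {w : Fin 2 → H} (hw : ∀ k, ‖w k‖ ≤ 1)
    {α : Matrix m (Unit × Fin 2) ℂ} (hα : scalarOpNorm α ≤ 1) (β : Matrix (Unit × Fin 2) n ℂ) :
    o.nrm (Matrix.bimul α (diagonalPair w) β) ≤ scalarOpNorm β := by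
  have nonneg := ho.isBimodular.nonneg (diagonalPair w)
  have le_one : o.nrm (diagonalPair w) ≤ 1 :=
    ho.nrm_blockDiagonal_le zero_le_one fun k => (h1 (w k)).trans_le (hw k)
  exact (ho.bimul_le α _ β).trans
    (mul_le_of_le_one_left (scalarOpNorm_nonneg β) (mul_le_one₀ hα nonneg le_one))

theorem IsOperatorSpace.col_one_le (ho : o.IsOperatorSpace) (h1 : ∀ ξ, o.one ξ = ‖ξ‖)
    (w : Fin 2 → H) : o.col.one w ≤ √(∑ k, ‖w k‖ ^ 2) := by
  let z (k : Fin 2) : H := ‖w k‖⁻¹ • w k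
  have norm_z (k : Fin 2) : ‖z k‖ ≤ 1 := by
    rcases eq_or_ne (w k) 0 with hk | hk <;> simp [z, norm_smul, hk]
  have norm_smul_z (k : Fin 2) : ‖w k‖ • z k = w k := by
    rcases eq_or_ne (w k) 0 with hk | hk <;> simp [z, hk]
  let β : Matrix (Unit × Fin 2) Unit ℂ := Matrix.of fun i _ => ‖w i.2‖
  have norm_β : scalarOpNorm β ≤ √(∑ k, ‖w k‖ ^ 2) := by
    refine scalarOpNorm_le (Real.sqrt_nonneg _) fun c => ?_
    rw [Real.sq_sqrt (by positivity)]
    simp [β, Fintype.sum_prod_type, mul_pow, add_mul]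
  have factor : (Matrix.of fun (i : Unit × Fin 2) (_ : Unit) => w i.2) =
      Matrix.bimul ((1 : Matrix _ _ ℂ).submatrix id id) (diagonalPair z) β := by
    ext ⟨i, k⟩ j
    simp [Matrix.bimul, Matrix.one_apply, diagonalPair, Matrix.blockDiagonal_apply, β,
      Fintype.sum_prod_type, norm_smul_z]
  exact (congrArg o.nrm factor).trans_le ((ho.nrm_bimul_diagonalPair_le h1 norm_z
    (scalarOpNorm_one_submatrix_left_le Function.injective_id) β).trans norm_β)

variable [CompleteSpace H]

variable (H)

theorem maxHilbert_leftM : (maxHilbert H).leftM = orthProj H := by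
  refine maxHilbert_isWeakOperatorSpace.isTwofoldSum_col.splitProj_eq_orthProj maxHilbert_one
    fun P hP ξ => le_antisymm (maxHilbert_le fun o ho h1 => ?_) ?_
  · refine (ho.col_one_le h1 (splitMap P ξ)).trans_eq ?_
    rw [Fin.sum_univ_two]
    exact (congrArg Real.sqrt (norm_sq_eq_add_of_mem_orthProj hP ξ).symm).trans
      (Real.sqrt_sq (norm_nonneg ξ))
  · have col_eq : (columnHilbert H).col.one (splitMap P ξ) = ‖ξ‖ :=
      (columnHilbert_col_splitMap hP (Matrix.of fun (_ _ : Unit) => ξ)).trans (columnHilbert_one ξ)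
    have col_le := columnHilbert_le_maxHilbert
      (Matrix.of fun (i : Unit × Fin 2) (_ : Unit) => splitMap P ξ i.2)
    exact col_eq.symm.trans_le col_le

theorem maxHilbert_leftL : (maxHilbert H).leftL = trivialProj H :=
  maxHilbert_isWeakOperatorSpace.isTwofoldSum_colProj.splitProj_eq_trivialProj maxHilbert_one
    fun _ _ h => ((Real.sqrt_two_lt_three_halves.trans (by norm_num)).trans_le
      (two_le_colProj_one maxHilbert_isWeakOperatorSpace rowHilbert_le_maxHilbert h)).ne'

theorem maxHilbert_completeLeftM : (maxHilbert H).completeLeftM = trivialProj H := by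
  refine maxHilbert_isWeakOperatorSpace.completeLeftM_eq.trans
    (maxHilbert_isWeakOperatorSpace.isTwofoldSum_col.completeSplitProj_eq_trivialProj_of_forall
      maxHilbert_one ?_)
  rintro P ⟨-, hP⟩ u v hu hv h
  have hu1 : ‖u‖ = 1 := h.1 0
  have hv1 : ‖v‖ = 1 := h.1 1
  let x : Matrix (Fin 2) (Fin 2) H := !![u, v; 0, 0]
  have le_x : 2 ≤ (maxHilbert H).nrm x ^ 2 := by
    have row_le := rowHilbert_le_maxHilbert x
    rw [← columnHilbert_op] at row_le
    have column_le := sum_norm_sq_smul_le_columnHilbert x.transpose ![1, 0]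
    have two_le : 2 ≤ (columnHilbert H).nrm x.transpose ^ 2 := by
      norm_num [Fin.sum_univ_two, x, hu1, hv1] at column_le
      exact column_le
    exact two_le.trans (pow_le_pow_left₀ (columnHilbert_nonneg _) row_le 2)
  let f (i : Unit × Fin 2) : Fin 2 × Fin 2 := (0, i.2)
  let g (k : Fin 2) : Unit × Fin 2 := ((), k)
  have factor : (Matrix.of fun (i : Fin 2 × Fin 2) j => splitMap P (x i.1 j) i.2) =
      Matrix.bimul ((1 : Matrix _ _ ℂ).submatrix id f) (diagonalPair ![u, v])
        ((1 : Matrix _ _ ℂ).submatrix id g) := by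
    ext ⟨i, k⟩ j
    fin_cases i <;> fin_cases k <;> fin_cases j <;>
      simp [Matrix.bimul, Matrix.one_apply, diagonalPair, Matrix.blockDiagonal_apply,
        Fintype.sum_prod_type, f, g, splitMap, x, hu, hv]
  have x_le : (maxHilbert H).col.nrm (x.map (splitMap P)) ≤ 1 :=
    maxHilbert_le fun o ho h1 => (congrArg o.nrm factor).trans_le
      ((ho.nrm_bimul_diagonalPair_le h1 (fun k => (h.1 k).le)
        (scalarOpNorm_one_submatrix_right_le (by decide)) _).trans
        (scalarOpNorm_one_submatrix_right_le (by decide)))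
  rw [hP 2 x] at x_le
  nlinarith [maxHilbert_isWeakOperatorSpace.nonneg x]

end Max

end MatrixNorms

end

theorem proposition6p10 {H : Type*} [NormedAddCommGroup H] [InnerProductSpace ℂ H]
    [CompleteSpace H] :
    -- the five rows of the table: left M, right L, right M, left L
    ((MatrixNorms.columnHilbert H).leftM = MatrixNorms.orthProj H ∧
      (MatrixNorms.columnHilbert H).rightL = MatrixNorms.trivialProj H ∧
      (MatrixNorms.columnHilbert H).rightM = MatrixNorms.trivialProj H ∧
      (MatrixNorms.columnHilbert H).leftL = MatrixNorms.orthProj H) ∧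
    ((MatrixNorms.rowHilbert H).leftM = MatrixNorms.trivialProj H ∧
      (MatrixNorms.rowHilbert H).rightL = MatrixNorms.orthProj H ∧
      (MatrixNorms.rowHilbert H).rightM = MatrixNorms.orthProj H ∧
      (MatrixNorms.rowHilbert H).leftL = MatrixNorms.trivialProj H) ∧
    ((MatrixNorms.operatorHilbert H).leftM = MatrixNorms.trivialProj H ∧
      (MatrixNorms.operatorHilbert H).rightL = MatrixNorms.trivialProj H ∧
      (MatrixNorms.operatorHilbert H).rightM = MatrixNorms.trivialProj H ∧
      (MatrixNorms.operatorHilbert H).leftL = MatrixNorms.trivialProj H) ∧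
    ((MatrixNorms.minHilbert H).leftM = MatrixNorms.trivialProj H ∧
      (MatrixNorms.minHilbert H).rightL = MatrixNorms.orthProj H ∧
      (MatrixNorms.minHilbert H).rightM = MatrixNorms.trivialProj H ∧
      (MatrixNorms.minHilbert H).leftL = MatrixNorms.orthProj H) ∧
    ((MatrixNorms.maxHilbert H).leftM = MatrixNorms.orthProj H ∧
      (MatrixNorms.maxHilbert H).rightL = MatrixNorms.trivialProj H ∧
      (MatrixNorms.maxHilbert H).rightM = MatrixNorms.orthProj H ∧
      (MatrixNorms.maxHilbert H).leftL = MatrixNorms.trivialProj H) ∧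
    -- the first three rows for the complete projections
    ((MatrixNorms.columnHilbert H).completeLeftM = MatrixNorms.orthProj H ∧
      (MatrixNorms.columnHilbert H).completeRightL = MatrixNorms.trivialProj H ∧
      (MatrixNorms.columnHilbert H).completeRightM = MatrixNorms.trivialProj H ∧
      (MatrixNorms.columnHilbert H).completeLeftL = MatrixNorms.orthProj H) ∧
    ((MatrixNorms.rowHilbert H).completeLeftM = MatrixNorms.trivialProj H ∧
      (MatrixNorms.rowHilbert H).completeRightL = MatrixNorms.orthProj H ∧
      (MatrixNorms.rowHilbert H).completeRightM = MatrixNorms.orthProj H ∧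
      (MatrixNorms.rowHilbert H).completeLeftL = MatrixNorms.trivialProj H) ∧
    ((MatrixNorms.operatorHilbert H).completeLeftM = MatrixNorms.trivialProj H ∧
      (MatrixNorms.operatorHilbert H).completeRightL = MatrixNorms.trivialProj H ∧
      (MatrixNorms.operatorHilbert H).completeRightM = MatrixNorms.trivialProj H ∧
      (MatrixNorms.operatorHilbert H).completeLeftL = MatrixNorms.trivialProj H) ∧
    -- `MAX(H)` and `MIN(H)` for the complete projections
    ((MatrixNorms.maxHilbert H).completeLeftM = MatrixNorms.trivialProj H ∧
      (MatrixNorms.maxHilbert H).completeRightM = MatrixNorms.trivialProj H) ∧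
    ((MatrixNorms.minHilbert H).completeLeftL = MatrixNorms.trivialProj H ∧
      (MatrixNorms.minHilbert H).completeRightL = MatrixNorms.trivialProj H) := by
  simp only [← MatrixNorms.op_leftM, ← MatrixNorms.op_leftL, ← MatrixNorms.op_completeLeftM,
    ← MatrixNorms.op_completeLeftL, MatrixNorms.columnHilbert_op, MatrixNorms.rowHilbert_op,
    MatrixNorms.operatorHilbert_op, MatrixNorms.minHilbert_op, MatrixNorms.maxHilbert_op,
    MatrixNorms.columnHilbert_leftM, MatrixNorms.columnHilbert_leftL,
    MatrixNorms.columnHilbert_completeLeftM, MatrixNorms.columnHilbert_completeLeftL,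
    MatrixNorms.rowHilbert_leftM, MatrixNorms.rowHilbert_leftL,
    MatrixNorms.rowHilbert_completeLeftM, MatrixNorms.rowHilbert_completeLeftL,
    MatrixNorms.operatorHilbert_leftM, MatrixNorms.operatorHilbert_leftL,
    MatrixNorms.operatorHilbert_completeLeftM, MatrixNorms.operatorHilbert_completeLeftL,
    MatrixNorms.minHilbert_leftM, MatrixNorms.minHilbert_leftL,
    MatrixNorms.minHilbert_completeLeftL, MatrixNorms.maxHilbert_leftM,
    MatrixNorms.maxHilbert_leftL, MatrixNorms.maxHilbert_completeLeftM, and_self]
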